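/- Let $(b_j)_{j\ge 0}$ be real numbers with $b_j\ge 0$ for $j\ne 1$ and $0<-b_1=\sum_{j\ne 1}b_j<\infty$. Let $\mathbb{N}\subset\mathbb{Z}_+$ be a finite set with $1\notin\mathbb{N}$ and $b_k>0$ for all $k\in\mathbb{N}$, and put $N=|\mathbb{N}|$. Let $(X(t),\mathbf{Y}(t))_{t\ge 0}$, $\mathbf{Y}(t)=(Y_k(t);\,k\in\mathbb{N})$, be a (regular) Markov branching process together with its crossing numbers. That is, it is a continuous-time Markov chain on $\mathbb{Z}_+\times\mathbb{Z}_+^{N}$ with right-continuous paths, started at $(1,\mathbf{0})$, whose transition function is honest (all row sums are $1$) and satisfies the Kolmogorov forward equation for the $Q$-matrix $$q_{(i,\mathbf{k}),(j,\mathbf{l})}=\begin{cases} i\,b_{j-i+1}, & i\ge 1,\ j-i+1\ge 0,\ j-i+1\notin\mathbb{N},\ \mathbf{l}=\mathbf{k},\\ i\,b_{j-i+1}, & i\ge 1,\ j-i+1\in\mathbb{N},\ \mathbf{l}=\mathbf{k}+\mathbf{e}_{j-i+1},\\ 0, & \text{otherwise.}\end{cases}$$ So $Y_k(t)$ counts the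 jumps of $X$ of size $k-1$ up to time $t$. Let $\tau=\inf\{t\ge 0: X(t)=0\}$. Put $B(u)=\sum_{j\ge 0}b_ju^j$, $\bar B_{\mathbb{N}}(u)=\sum_{j\notin\mathbb{N}}b_ju^j$ and $B_{\mathbb{N}}(u,\mathbf{v})=\sum_{j\in\mathbb{N}}b_jv_ju^j$. Let $\rho$ be the minimal nonnegative root of $B(u)=0$ and, for $\mathbf{v}\in[0,1]^N$, let $\rho(\mathbf{v})$ be the minimal nonnegative root of $\bar B_{\mathbb{N}}(u)+B_{\mathbb{N}}(u,\mathbf{v})=0$. Then these minimal roots exist, lie in $[0,1]$, and the following hold. 1. $P(\tau<\infty)=\rho$. 2. If $\rho>0$, the probability generating function of $\mathbf{Y}(\tau)$ conditioned on $\tau<\infty$ is $$\sum_{\mathbf{l}\in\mathbb{Z}_+^N}P(\mathbf{Y}(\tau)=\mathbf{l}\mid\tau<\infty)\,\mathbf{v}^{\mathbf{l}}=\rho^{-1}\rho(\mathbf{v}),\qquad \mathbf{v}\in[0,1]^N.$$ 3. For every $\mathbf{v}\in[0,1]^N$ such that $\mathbf{v}\ne\mathbf{1}$ or $\rho=1$,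 the problem $\frac{\partial y}{\partial t}=B_{\mathbb{N}}(y,\mathbf{v})+\bar B_{\mathbb{N}}(y)$, $y(0)=1$, has a unique solution $y(t)=G(t,1,\mathbf{v})$, $t\ge 0$, with values in $[0,1]$, and $$G(\infty,1,\mathbf{v}):=\lim_{t\to\infty}G(t,1,\mathbf{v})=\rho(\mathbf{v}).$$ Hence, for such $\mathbf{v}$ and $\rho>0$, the generating function in 2 equals $\rho^{-1}G(\infty,1,\mathbf{v})$. 4. If $\rho<1$, then $P(\lim_{t\to\infty}Y_k(t)=\infty\text{ for all }k\in\mathbb{N}\mid\tau=\infty)=1$. -/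

import Mathlib

open Set Filter Topology MeasureTheory ProbabilityTheory
open scoped NNReal ENNReal

noncomputable section

/-- Branching rates: `b j ≥ 0` for `j ≠ 1` and `0 < -b 1 = ∑_{j ≠ 1} b j < ∞`. -/
structure IsBranchingRates (b : ℕ → ℝ) : Prop where
  nonneg : ∀ j, j ≠ 1 → 0 ≤ b j
  neg_one : b 1 < 0
  hasSum : HasSum (fun j => if j = 1 then 0 else b j) (-b 1)

/-- `B(u) = ∑_j b_j u^j`, for `u ∈ [0,1]`. -/
def genB (b : ℕ → ℝ) (u : ℝ) : ℝ := ∑' j, b j * u ^ j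

/-- `B_N(u, v) = ∑_{j ∈ N} b_j v_j u^j`. -/
def genBN (b : ℕ → ℝ) (N : Finset ℕ) (u : ℝ) (v : N → ℝ) : ℝ :=
  ∑ j : N, b j * v j * u ^ (j : ℕ)

/-- `B̄_N(u) = ∑_{j ∉ N} b_j u^j`, for `u ∈ [0,1]`. -/
def genBbar (b : ℕ → ℝ) (N : Finset ℕ) (u : ℝ) : ℝ :=
  ∑' j, if j ∈ N then 0 else b j * u ^ j

/-- The roots of `B(u) = 0` in `[0,1]`. Since `u = 1` is a root, the least nonnegative root of `B`
is the least element of this set. -/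
def rootsB (b : ℕ → ℝ) : Set ℝ := {u | u ∈ Icc (0 : ℝ) 1 ∧ genB b u = 0}

/-- The roots of `B̄_N(u) + B_N(u, v) = 0` in `[0,1]`. For `v ∈ [0,1]^N` the left side is
nonnegative at `0` and nonpositive at `1`, so the least nonnegative root lies in `[0,1]`. -/
def rootsBN (b : ℕ → ℝ) (N : Finset ℕ) (v : N → ℝ) : Set ℝ :=
  {u | u ∈ Icc (0 : ℝ) 1 ∧ genBbar b N u + genBN b N u v = 0}

/-- `ρ`, the least nonnegative root of `B(u) = 0`. -/
def rho (b : ℕ → ℝ) : ℝ := sInf (rootsB b)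

/-- `ρ(v)`, the least nonnegative root of `B̄_N(u) + B_N(u, v) = 0`. -/
def rhoN (b : ℕ → ℝ) (N : Finset ℕ) (v : N → ℝ) : ℝ := sInf (rootsBN b N v)

/-- `y : [0,∞) → [0,1]` solves `y' = B_N(y, v) + B̄_N(y)`, `y(0) = u`
(with the one-sided derivative at time `0`). -/
structure IsFlow (b : ℕ → ℝ) (N : Finset ℕ) (v : N → ℝ) (u : ℝ) (y : ℝ → ℝ) : Prop where
  init : y 0 = u
  mem : ∀ t, 0 ≤ t → y t ∈ Icc (0 : ℝ) 1
  deriv : ∀ t, 0 ≤ t →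
    HasDerivWithinAt y (genBN b N (y t) v + genBbar b N (y t)) (Ici 0) t

/-- States `(i, k)`: `i` particles are alive and, for each `n ∈ N`, exactly `k n` jumps of size
`n - 1` have been counted. -/
abbrev CrossState (N : Finset ℕ) : Type := ℕ × (N → ℕ)

/-- The `Q`-matrix of the branching process together with its crossing counters. From `(i, k)` with
`i ≥ 1` the chain moves at rate `i * b m` to `(i + m - 1, k)` if `m ∉ N`, and to
`(i + m - 1, k + e_m)` if `m ∈ N`; the case `m = 1` is the diagonal entry `i * b 1`.
States with `i = 0` are absorbing. -/
def crossingQ (b : ℕ → ℝ) (N : Finset ℕ) (x y : CrossState N) : ℝ :=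
  if 1 ≤ x.1 ∧ x.1 ≤ y.1 + 1 ∧
      ∀ n : N, y.2 n = x.2 n + (if (n : ℕ) = y.1 + 1 - x.1 then 1 else 0) then
    (x.1 : ℝ) * b (y.1 + 1 - x.1)
  else 0

/-- An honest transition function `(p_{xy}(t))`, `t ≥ 0`, on the state space `S`. -/
structure IsTransitionFunction {S : Type*} [DecidableEq S] (p : ℝ → S → S → ℝ) : Prop where
  nonneg : ∀ t, 0 ≤ t → ∀ x y, 0 ≤ p t x y
  honest : ∀ t, 0 ≤ t → ∀ x, HasSum (fun y => p t x y) 1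
  zero : ∀ x y, p 0 x y = if x = y then 1 else 0
  chapman : ∀ s t, 0 ≤ s → 0 ≤ t → ∀ x z, HasSum (fun y => p s x y * p t y z) (p (s + t) x z)

/-- The Kolmogorov forward equation `p'_{xz}(t) = ∑_y p_{xy}(t) q_{yz}`, `t ≥ 0`. -/
def ForwardEquation {S : Type*} (p : ℝ → S → S → ℝ) (q : S → S → ℝ) : Prop :=
  ∀ x z t, 0 ≤ t → Summable (fun y => p t x y * q y z) ∧
    HasDerivWithinAt (fun s => p s x z) (∑' y, p t x y * q y z) (Ici 0) t

/-- `Z` is a continuous-time Markov chain on the countable discrete state space `S`, started at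
`z₀`, with transition function `p` and right-continuous paths: its finite-dimensional distributions
are the products of transition probabilities. -/
structure IsMarkovChain {Ω S : Type*} [MeasurableSpace Ω] [MeasurableSpace S] [DecidableEq S]
    (μ : Measure Ω) (p : ℝ → S → S → ℝ) (z₀ : S) (Z : ℝ≥0 → Ω → S) : Prop where
  measurable : ∀ t, Measurable (Z t)
  fdd : ∀ (n : ℕ) (t : Fin (n + 1) → ℝ≥0), t 0 = 0 → Monotone t → ∀ z : Fin (n + 1) → S,
    μ.real {ω | ∀ k, Z (t k) ω = z k} =
      (if z 0 = z₀ then 1 else 0) *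
        ∏ k : Fin n, p ((t k.succ : ℝ) - t k.castSucc) (z k.castSucc) (z k.succ)
  rightCont : ∀ ω t, ∀ᶠ s in 𝓝[≥] t, Z s ω = Z t ω

/-- The extinction time `τ = inf {t ≥ 0 : X(t) = 0}`, equal to `∞` if there is no such `t`. -/
def extinctionTime {Ω : Type*} {N : Finset ℕ} (Z : ℝ≥0 → Ω → CrossState N) (ω : Ω) : ℝ≥0∞ :=
  ⨅ (t : ℝ≥0) (_ : (Z t ω).1 = 0), (t : ℝ≥0∞)

/-- `Y(τ)`, the crossing numbers at extinction (used on the event `τ < ∞`). -/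
def crossingAtExtinction {Ω : Type*} {N : Finset ℕ} (Z : ℝ≥0 → Ω → CrossState N) (ω : Ω) :
    N → ℕ :=
  (Z (extinctionTime Z ω).toNNReal ω).2

end

/-!
The proof works with the generating function `F(t, u, v) = E[u ^ X(t) * ∏ v_k ^ Y_k(t)]` of the
transition probabilities (`stateGen`) and with the field `f_v(u) = B̄_N(u) + B_N(u, v)`
(`markedGen`). For `u < 1`, summing the forward equation against the monomials `uʲ vˡ` gives
`F(t, u, v) - F(s, u, v) = f_v(u) ∫_s^t ∂ᵤF` (`stateGen_sub_eq_integral`). Since `∂ᵤF ≥ 0`, the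
sign of `f_v(u)` decides whether `F(·, u, v)` increases or decreases, and `∂ᵤF` is at least
`F(t, u, v) - F(t, 0, v)`, the contribution of the event `X(t) ≥ 1`. Neither the solution of the
transport equation nor the branching property is needed: three consequences of this identity
suffice.

* Let `r = ρ(v)`. As `f_v(r) = 0`, `F(t, 0, v) ≤ F(t, r, v) = r`. For `w < u < r`, `f_v(u) > 0`
  and `F(t, u, v) ≥ u`; if `F(t, 0, v)` stayed below `w`, then `F(t, u, v)` would grow linearly.
  Hence `F(t, 0, v) → ρ(v)` (`tendsto_stateGen_zero`).
* If some `v_k < 1`, then `f_v` is at most a negative constant near `u = 1`, and so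
  `F(t, 1, v) - F(t, 0, v) = O(1 / t)` (`exists_mul_stateGen_sub_le`).
* In the same situation `F(·, u, v)` decreases for `u` near `1`; taking `v_k` small shows that `Y_k`
  cannot decrease (`transition_eq_zero_of_counter_lt`).

States without particles are absorbing, so the path facts follow from right-continuity:
`F(t, 0, v)` is the generating function of `Y(τ)` on `τ ≤ t`, and its limit gives the law of
`Y(τ)` on extinction and, at `v = 1`, the extinction probability. On survival the `O(1 / t)` bound
with `v_k = 1 / 2` excludes that `Y_k` stays bounded.

The flow `y' = f_v(y)`, `y(0) = 1`, is treated separately, because `f_v` need not be Lipschitz at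
`1`. By convexity `f_v` is negative on `(r, 1]` and lies above a line through `(r, 0)`, so that after
a logarithmic change of variable the field is positive and bounded, and the equation is solved by
inverting the elapsed time (`exists_unique_descending_solution`).
-/

/-! ### Power series whose coefficients are nonnegative except for the linear one -/

/-- The tangent line inequality for `u ↦ u ^ n` on `[0, ∞)`. -/
theorem pow_add_mul_sub_le_pow {a u : ℝ} (ha : 0 ≤ a) (hu : 0 ≤ u) (n : ℕ) :
    a ^ n + n * a ^ (n - 1) * (u - a) ≤ u ^ n := by
  induction n with
  | zero => simp
  | succ n ih =>
    rcases Nat.eq_zero_or_pos n with rfl | hn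
    · simp
    · obtain ⟨m, rfl⟩ : ∃ m, n = m + 1 := ⟨n - 1, by omega⟩
      simp only [Nat.add_sub_cancel] at ih ⊢
      have h1 := mul_le_mul_of_nonneg_right ih hu
      have h2 : 0 ≤ ((m + 1 : ℕ) : ℝ) * a ^ m * (u - a) ^ 2 := by positivity
      calc a ^ (m + 1 + 1) + ((m + 1 + 1 : ℕ) : ℝ) * a ^ (m + 1) * (u - a)
          ≤ (a ^ (m + 1) + ((m + 1 : ℕ) : ℝ) * a ^ m * (u - a)) * u := by
            rw [← sub_nonneg]
            refine h2.trans_eq ?_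
            push_cast
            ring
        _ ≤ u ^ (m + 1) * u := h1
        _ = u ^ (m + 1 + 1) := (pow_succ _ _).symm

theorem nat_mul_pow_pred_le {u : ℝ} (hu0 : 0 ≤ u) (hu1 : u < 1) (n : ℕ) :
    (n : ℝ) * u ^ (n - 1) ≤ (1 - u)⁻¹ := by
  have h := pow_add_mul_sub_le_pow hu0 zero_le_one n
  rw [one_pow] at h
  have h1 : (0 : ℝ) ≤ u ^ n := by positivity
  rw [← one_div, le_div_iff₀ (by linarith)]
  linarith

section SignedSeries

variable {c : ℕ → ℝ}

theorem abs_mul_pow_le {u : ℝ} (hu : u ∈ Icc (0 : ℝ) 1) (a : ℝ) (j : ℕ) : |a * u ^ j| ≤ |a| := by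
  rw [abs_mul, abs_of_nonneg (pow_nonneg hu.1 j)]
  exact mul_le_of_le_one_right (abs_nonneg _) (pow_le_one₀ hu.1 hu.2)

theorem summable_mul_pow (hc : Summable fun j => |c j|) {u : ℝ} (hu : u ∈ Icc (0 : ℝ) 1) :
    Summable fun j => c j * u ^ j :=
  Summable.of_abs (hc.of_nonneg_of_le (fun _ => abs_nonneg _) fun j => abs_mul_pow_le hu (c j) j)

theorem continuousOn_tsum_mul_pow (hc : Summable fun j => |c j|) :
    ContinuousOn (fun u : ℝ => ∑' j, c j * u ^ j) (Icc 0 1) :=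
  continuousOn_tsum (fun j => by fun_prop) hc fun j u hu => abs_mul_pow_le hu (c j) j

/-- Away from `1`, the graph of the series lies above a tangent line: every term but the linear
one is convex. -/
theorem exists_tangent_le_tsum (hc : Summable fun j => |c j|) (hpos : ∀ j, j ≠ 1 → 0 ≤ c j)
    {a : ℝ} (ha0 : 0 ≤ a) (ha1 : a < 1) :
    ∃ s : ℝ, ∀ u ∈ Icc (0 : ℝ) 1,
      (∑' j, c j * a ^ j) + s * (u - a) ≤ ∑' j, c j * u ^ j := by
  have hs : Summable fun j : ℕ => c j * (j * a ^ (j - 1)) := by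
    refine Summable.of_abs ((hc.mul_right (1 - a)⁻¹).of_nonneg_of_le (fun _ => abs_nonneg _)
      fun j => ?_)
    rw [abs_mul, abs_of_nonneg (by positivity : (0 : ℝ) ≤ j * a ^ (j - 1))]
    exact mul_le_mul_of_nonneg_left (nat_mul_pow_pred_le ha0 ha1 j) (abs_nonneg _)
  refine ⟨∑' j : ℕ, c j * (j * a ^ (j - 1)), fun u hu => ?_⟩
  have hA := summable_mul_pow hc (u := a) ⟨ha0, ha1.le⟩
  rw [← tsum_mul_right, ← hA.tsum_add (hs.mul_right _)]
  refine (hA.add (hs.mul_right _)).tsum_le_tsum (fun j => ?_) (summable_mul_pow hc hu)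
  by_cases hj : j = 1
  · subst hj; simp; linarith
  · have := mul_le_mul_of_nonneg_left (pow_add_mul_sub_le_pow ha0 hu.1 j) (hpos j hj)
    linarith

theorem isLeast_roots (hc : Summable fun j => |c j|) (h0 : 0 ≤ c 0) (h1 : ∑' j, c j ≤ 0) :
    IsLeast {u | u ∈ Icc (0 : ℝ) 1 ∧ ∑' j, c j * u ^ j = 0}
      (sInf {u | u ∈ Icc (0 : ℝ) 1 ∧ ∑' j, c j * u ^ j = 0}) := by
  have hcont := continuousOn_tsum_mul_pow hc
  have hf0 : ∑' j, c j * (0 : ℝ) ^ j = c 0 := by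
    rw [tsum_eq_single 0 (fun j hj => by simp [hj])]; simp
  have hne : {u | u ∈ Icc (0 : ℝ) 1 ∧ ∑' j, c j * u ^ j = 0}.Nonempty := by
    obtain ⟨u, hu, h⟩ := intermediate_value_Icc' zero_le_one hcont
      (show (0 : ℝ) ∈ Icc (∑' j, c j * (1 : ℝ) ^ j) (∑' j, c j * (0 : ℝ) ^ j) by
        rw [hf0]; simpa using ⟨h1, h0⟩)
    exact ⟨u, hu, h⟩
  have hbdd : BddBelow {u | u ∈ Icc (0 : ℝ) 1 ∧ ∑' j, c j * u ^ j = 0} :=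
    ⟨0, fun u hu => hu.1.1⟩
  have hclosed : IsClosed {u | u ∈ Icc (0 : ℝ) 1 ∧ ∑' j, c j * u ^ j = 0} :=
    hcont.preimage_isClosed_of_isClosed isClosed_Icc isClosed_singleton
  exact ⟨hclosed.csInf_mem hne hbdd, fun u hu => csInf_le hbdd hu⟩

theorem tsum_pos_of_lt_least_root (hc : Summable fun j => |c j|) (h0 : 0 ≤ c 0) {r : ℝ}
    (hr : IsLeast {u | u ∈ Icc (0 : ℝ) 1 ∧ ∑' j, c j * u ^ j = 0} r) {u : ℝ} (hu0 : 0 ≤ u)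
    (hur : u < r) : 0 < ∑' j, c j * u ^ j := by
  by_contra! h
  have hf0 : ∑' j, c j * (0 : ℝ) ^ j = c 0 := by
    rw [tsum_eq_single 0 (fun j hj => by simp [hj])]; simp
  have hu1 : u ≤ 1 := hur.le.trans hr.1.1.2
  obtain ⟨w, hw, hw'⟩ := intermediate_value_Icc' hu0
    ((continuousOn_tsum_mul_pow hc).mono (Icc_subset_Icc_right hu1))
    (show (0 : ℝ) ∈ Icc (∑' j, c j * u ^ j) (∑' j, c j * (0 : ℝ) ^ j) by
      rw [hf0]; exact ⟨h, h0⟩)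
  exact absurd (hr.2 ⟨⟨hw.1, hw.2.trans hu1⟩, hw'⟩) (not_le.2 (hw.2.trans_lt hur))

/-- By convexity, a series that vanishes at `r < 1` and is negative at `1` is negative between. -/
theorem tsum_neg_of_root_lt (hc : Summable fun j => |c j|) (hpos : ∀ j, j ≠ 1 → 0 ≤ c j)
    (h1 : ∑' j, c j < 0) {r : ℝ} (hr : r ∈ Icc (0 : ℝ) 1) (hroot : ∑' j, c j * r ^ j = 0) {u : ℝ}
    (hur : r < u) (hu1 : u ≤ 1) : ∑' j, c j * u ^ j < 0 := by
  rcases hu1.eq_or_lt with rfl | hu1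
  · simpa using h1
  by_contra! h
  obtain ⟨s, hs⟩ := exists_tangent_le_tsum hc hpos (hr.1.trans hur.le) hu1
  have e1 := hs 1 ⟨zero_le_one, le_rfl⟩
  have e2 := hs r hr
  simp only [one_pow, mul_one] at e1
  rw [hroot] at e2
  have hs0 : s < 0 := by
    by_contra! hs0
    have := mul_nonneg hs0 (by linarith : 0 ≤ 1 - u)
    linarith
  nlinarith

end SignedSeries

/-! ### The generating function of the marked offspring rates -/

section Rates

variable {b : ℕ → ℝ} {N : Finset ℕ} {v : N → ℝ}

/-- The factor by which a jump of size `m - 1` multiplies `∏ k, v k ^ Y_k`: it is `v m` if `m ∈ N`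
and `1` otherwise. -/
noncomputable def markFactor (v : N → ℝ) (m : ℕ) : ℝ := if h : m ∈ N then v ⟨m, h⟩ else 1

/-- The series `B̄_N(u) + B_N(u, v)`, written as `∑ₘ bₘ wₘ uᵐ` with the mark factors `wₘ`. -/
noncomputable def markedGen (b : ℕ → ℝ) (N : Finset ℕ) (v : N → ℝ) (u : ℝ) : ℝ :=
  ∑' m, b m * markFactor v m * u ^ m

theorem markFactor_mem (hv : ∀ k, v k ∈ Icc (0 : ℝ) 1) (m : ℕ) :
    markFactor v m ∈ Icc (0 : ℝ) 1 := by
  unfold markFactor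
  split_ifs with h
  · exact hv _
  · simp

theorem markFactor_one (m : ℕ) : markFactor (1 : N → ℝ) m = 1 := by
  unfold markFactor; split_ifs <;> rfl

namespace IsBranchingRates

theorem summable_abs (hb : IsBranchingRates b) : Summable fun j => |b j| := by
  rw [← summable_nat_add_iff 2]
  refine ((summable_nat_add_iff 2).2 hb.hasSum.summable).congr fun j => ?_
  rw [if_neg (by omega), abs_of_nonneg (hb.nonneg _ (by omega))]

theorem tsum_eq_zero (hb : IsBranchingRates b) : ∑' j, b j = 0 := by
  have h := hb.hasSum.add (hasSum_ite_eq 1 (b 1))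
  rw [neg_add_cancel] at h
  refine (h.congr_fun ?_).tsum_eq
  intro j
  by_cases hj : j = 1 <;> simp [hj]

theorem abs_le (hb : IsBranchingRates b) (j : ℕ) : |b j| ≤ -b 1 := by
  by_cases hj : j = 1
  · rw [hj, abs_of_neg hb.neg_one]
  · rw [abs_of_nonneg (hb.nonneg j hj)]
    have := le_hasSum hb.hasSum j fun i _ => by
      split_ifs with h
      · exact le_rfl
      · exact hb.nonneg i h
    simpa [hj] using this

theorem abs_mul_markFactor_le (hv : ∀ k, v k ∈ Icc (0 : ℝ) 1) (j : ℕ) :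
    |b j * markFactor v j| ≤ |b j| := by
  have := markFactor_mem hv j
  rw [abs_mul, abs_of_nonneg this.1]
  exact mul_le_of_le_one_right (abs_nonneg _) this.2

theorem summable_abs_marked (hb : IsBranchingRates b) (hv : ∀ k, v k ∈ Icc (0 : ℝ) 1) :
    Summable fun j => |b j * markFactor v j| :=
  hb.summable_abs.of_nonneg_of_le (fun _ => abs_nonneg _) (abs_mul_markFactor_le hv)

theorem marked_nonneg (hb : IsBranchingRates b) (hv : ∀ k, v k ∈ Icc (0 : ℝ) 1) (j : ℕ)
    (hj : j ≠ 1) : 0 ≤ b j * markFactor v j :=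
  mul_nonneg (hb.nonneg j hj) (markFactor_mem hv j).1

theorem marked_le (hb : IsBranchingRates b) (hN1 : 1 ∉ N) (hv : ∀ k, v k ∈ Icc (0 : ℝ) 1)
    (j : ℕ) : b j * markFactor v j ≤ b j := by
  by_cases hj : j = 1
  · subst hj; simp [markFactor, hN1]
  · exact mul_le_of_le_one_right (hb.nonneg j hj) (markFactor_mem hv j).2

theorem tsum_marked_nonpos (hb : IsBranchingRates b) (hN1 : 1 ∉ N)
    (hv : ∀ k, v k ∈ Icc (0 : ℝ) 1) : ∑' j, b j * markFactor v j ≤ 0 := by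
  rw [← hb.tsum_eq_zero]
  exact (hb.summable_abs_marked hv).of_abs.tsum_le_tsum (hb.marked_le hN1 hv) hb.summable_abs.of_abs

theorem tsum_marked_neg (hb : IsBranchingRates b) (hN1 : 1 ∉ N) (hNpos : ∀ k ∈ N, 0 < b k)
    (hv : ∀ k, v k ∈ Icc (0 : ℝ) 1) {k : N} (hk : v k ≠ 1) :
    ∑' j, b j * markFactor v j < 0 := by
  rw [← hb.tsum_eq_zero]
  refine (hb.summable_abs_marked hv).of_abs.tsum_lt_tsum (i := (k : ℕ)) (hb.marked_le hN1 hv) ?_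
    hb.summable_abs.of_abs
  have h1 : markFactor v k < 1 := by
    simp only [markFactor, k.2, dite_true]
    exact lt_of_le_of_ne (hv k).2 hk
  exact mul_lt_of_lt_one_right (hNpos k k.2) h1

theorem genBbar_add_genBN (hb : IsBranchingRates b) {u : ℝ} (hu : u ∈ Icc (0 : ℝ) 1) :
    genBbar b N u + genBN b N u v = markedGen b N v u := by
  have h1 : HasSum (fun j => if h : j ∈ N then b j * v ⟨j, h⟩ * u ^ j else 0)
      (genBN b N u v) := by
    have h : genBN b N u v = ∑ j ∈ N, if h : j ∈ N then b j * v ⟨j, h⟩ * u ^ j else 0 := by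
      rw [genBN, ← Finset.sum_coe_sort N]
      exact Finset.sum_congr rfl fun j _ => by simp
    rw [h]
    exact hasSum_sum_of_ne_finset_zero fun j hj => by simp [hj]
  have h2 : Summable fun j => if j ∈ N then 0 else b j * u ^ j := by
    refine Summable.of_abs (hb.summable_abs.of_nonneg_of_le (fun _ => abs_nonneg _) fun j => ?_)
    split_ifs
    · simp
    · exact abs_mul_pow_le hu _ _
  refine ((h2.hasSum.add h1).congr_fun fun j => ?_).tsum_eq.symm
  unfold markFactor
  split_ifs <;> simp

theorem rootsBN_eq (hb : IsBranchingRates b) :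
    rootsBN b N v = {u | u ∈ Icc (0 : ℝ) 1 ∧ markedGen b N v u = 0} := by
  ext u
  exact and_congr_right fun hu => by rw [hb.genBbar_add_genBN hu]

theorem rootsB_eq : rootsB b = {u | u ∈ Icc (0 : ℝ) 1 ∧ markedGen b N 1 u = 0} := by
  simp [rootsB, genB, markedGen, markFactor_one]

theorem isLeast_rhoN (hb : IsBranchingRates b) (hN1 : 1 ∉ N) (hv : ∀ k, v k ∈ Icc (0 : ℝ) 1) :
    IsLeast (rootsBN b N v) (rhoN b N v) := by
  rw [rhoN, hb.rootsBN_eq]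
  exact isLeast_roots (hb.summable_abs_marked hv) (hb.marked_nonneg hv 0 zero_ne_one)
    (hb.tsum_marked_nonpos hN1 hv)

theorem rhoN_one (hb : IsBranchingRates b) : rhoN b N 1 = rho b := by
  rw [rhoN, rho, hb.rootsBN_eq, rootsB_eq]

end IsBranchingRates

end Rates

/-! ### A scalar autonomous equation descending to a rest point -/

/-- For a continuous, positive and bounded field `h` on the line, the elapsed time
`∫ 1 / h` is an order isomorphism of `ℝ`, whose inverse is the solution of `x' = h x`. -/
theorem exists_timeChange {h : ℝ → ℝ} (hc : Continuous h) (hpos : ∀ x, 0 < h x) {C : ℝ}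
    (hC : ∀ x, h x ≤ C) :
    ∃ S : ℝ ≃o ℝ, S 0 = 0 ∧ ∀ x, HasDerivAt S (h x)⁻¹ x := by
  have hCpos : 0 < C := (hpos 0).trans_le (hC 0)
  have hci : Continuous fun x => (h x)⁻¹ := hc.inv₀ fun x => (hpos x).ne'
  set S : ℝ → ℝ := fun x => ∫ y in (0 : ℝ)..x, (h y)⁻¹ with hS
  have hder : ∀ x, HasDerivAt S (h x)⁻¹ x := fun x => by
    exact intervalIntegral.integral_hasDerivAt_right (hci.intervalIntegrable _ _)
      (hci.stronglyMeasurableAtFilter _ _) hci.continuousAt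
  have hcont : Continuous S := continuous_iff_continuousAt.2 fun x => (hder x).continuousAt
  have hmono : StrictMono S := strictMono_of_deriv_pos fun x => by
    rw [(hder x).deriv]; exact inv_pos.2 (hpos x)
  have hS0 : S 0 = 0 := by simp [hS]
  have hlin : Monotone fun x => S x - C⁻¹ * x := by
    have hd : ∀ x, HasDerivAt (fun x => S x - C⁻¹ * x) ((h x)⁻¹ - C⁻¹) x := fun x => by
      simpa using (hder x).fun_sub ((hasDerivAt_id x).const_mul C⁻¹)
    refine monotone_of_deriv_nonneg (fun x => (hd x).differentiableAt) fun x => ?_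
    rw [(hd x).deriv, sub_nonneg]
    exact inv_anti₀ (hpos x) (hC x)
  have htop : Tendsto S atTop atTop := by
    refine tendsto_atTop_mono' _ ?_ (tendsto_id.const_mul_atTop (inv_pos.2 hCpos))
    filter_upwards [eventually_ge_atTop 0] with x hx
    have := hlin hx
    simp only [hS0, mul_zero, sub_zero] at this
    simpa using this
  have hbot : Tendsto S atBot atBot := by
    refine tendsto_atBot_mono' _ ?_ (tendsto_id.const_mul_atBot (inv_pos.2 hCpos))
    filter_upwards [eventually_le_atBot 0] with x hx
    have := hlin hx
    simp only [hS0, mul_zero, sub_zero] at this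
    simpa using this
  exact ⟨hmono.orderIsoOfSurjective S (hcont.surjective htop hbot), hS0, hder⟩

/-- If `f` is continuous on `[0, 1]`, negative on `(r, 1]` and at least `-C (u - r)`, then
`y' = f y`, `y 0 = 1` has a unique solution in `[0, 1]`, and it converges to `r`. In the coordinate
`x`, `y = r + (1 - r) e⁻ˣ`, the equation becomes `x' = h x` with `h` positive and bounded by `C`.
The field need not be Lipschitz at the starting point `1`. -/
theorem exists_unique_descending_solution {f : ℝ → ℝ} (hf : ContinuousOn f (Icc 0 1)) {r C : ℝ}
    (hr0 : 0 ≤ r) (hr1 : r < 1) (hneg : ∀ u, r < u → u ≤ 1 → f u < 0)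
    (hC : ∀ u ∈ Icc (0 : ℝ) 1, -C * (u - r) ≤ f u) :
    ∃ G : ℝ → ℝ, (G 0 = 1 ∧ (∀ t, 0 ≤ t → G t ∈ Icc (0 : ℝ) 1) ∧
      ∀ t, 0 ≤ t → HasDerivWithinAt G (f (G t)) (Ici 0) t) ∧
      (∀ y : ℝ → ℝ, y 0 = 1 → (∀ t, 0 ≤ t → y t ∈ Icc (0 : ℝ) 1) →
        (∀ t, 0 ≤ t → HasDerivWithinAt y (f (y t)) (Ici 0) t) → ∀ t, 0 ≤ t → y t = G t) ∧
      Tendsto G atTop (𝓝 r) := by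
  have hr' : 0 < 1 - r := sub_pos.2 hr1
  set e : ℝ → ℝ := fun x => r + (1 - r) * Real.exp (-x) with he
  have he_gt : ∀ x, r < e x := fun x => by
    have := mul_pos hr' (Real.exp_pos (-x)); simp only [he]; linarith
  have he_le : ∀ x, 0 ≤ x → e x ≤ 1 := fun x hx => by
    have : Real.exp (-x) ≤ 1 := Real.exp_le_one_iff.2 (by linarith)
    have := mul_le_mul_of_nonneg_left this hr'.le
    simp only [he]; linarith
  have he_mem : ∀ x, 0 ≤ x → e x ∈ Icc (0 : ℝ) 1 := fun x hx =>
    ⟨hr0.trans (he_gt x).le, he_le x hx⟩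
  have hec : Continuous e := by fun_prop
  set h : ℝ → ℝ := fun x => -f (e (max x 0)) / (e (max x 0) - r) with hh
  have hh_cont : Continuous h := by
    have h1 : Continuous fun x : ℝ => e (max x 0) := by fun_prop
    have h2 : Continuous fun x : ℝ => f (e (max x 0)) :=
      hf.comp_continuous h1 fun x => he_mem _ (le_max_right _ _)
    exact h2.neg.div (h1.sub continuous_const) fun x => (sub_pos.2 (he_gt _)).ne'
  have hh_pos : ∀ x, 0 < h x := fun x =>
    div_pos (neg_pos.2 (hneg _ (he_gt _) (he_le _ (le_max_right _ _)))) (sub_pos.2 (he_gt _))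
  have hh_le : ∀ x, h x ≤ C := fun x => by
    rw [hh, div_le_iff₀ (sub_pos.2 (he_gt _))]
    have := hC _ (he_mem _ (le_max_right x 0))
    linarith
  obtain ⟨S, hS0, hSder⟩ := exists_timeChange hh_cont hh_pos hh_le
  have hsymm0 : S.symm 0 = 0 := by rw [← hS0, S.symm_apply_apply, hS0]
  have hsymm_nonneg : ∀ t, 0 ≤ t → 0 ≤ S.symm t := fun t ht => by
    rw [← hsymm0]; exact S.symm.monotone ht
  have hsymm_der : ∀ t, HasDerivAt S.symm (h (S.symm t)) t := fun t => by
    have := HasDerivAt.of_local_left_inverse (g := S.symm) S.symm.continuous.continuousAt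
      (hSder (S.symm t)) (inv_ne_zero (hh_pos _).ne') (Eventually.of_forall S.apply_symm_apply)
    rwa [inv_inv] at this
  refine ⟨fun t => e (S.symm t), ⟨?_, fun t ht => he_mem _ (hsymm_nonneg t ht), fun t ht => ?_⟩,
    fun y hy0 hymem hyder t ht => ?_, ?_⟩
  · simp [hsymm0, he]
  · have hd : HasDerivAt (fun t => e (S.symm t))
        ((1 - r) * (Real.exp (-S.symm t) * -h (S.symm t))) t :=
      (((hsymm_der t).neg.exp).const_mul (1 - r)).const_add r
    convert! hd.hasDerivWithinAt using 1
    have hx : max (S.symm t) 0 = S.symm t := max_eq_left (hsymm_nonneg t ht)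
    simp only [hh, hx]
    have h0 : e (S.symm t) - r = (1 - r) * Real.exp (-S.symm t) := by simp [he]
    rw [h0]
    have := (Real.exp_pos (-S.symm t)).ne'
    field_simp
  · -- `exp (C t) (y t - r)` is nondecreasing, so `y` stays above `r`
    have hyr : ∀ t, 0 ≤ t → r < y t := by
      intro t ht
      have hd : ∀ s, 0 ≤ s → HasDerivWithinAt (fun s => Real.exp (C * s) * (y s - r))
          (Real.exp (C * s) * (C * 1) * (y s - r) + Real.exp (C * s) * f (y s)) (Ici 0) s :=
        fun s hs => ((((hasDerivAt_id s).const_mul C).exp).hasDerivWithinAt).mul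
          ((hyder s hs).sub_const r)
      have hm : MonotoneOn (fun s => Real.exp (C * s) * (y s - r)) (Ici 0) := by
        refine monotoneOn_of_hasDerivWithinAt_nonneg (convex_Ici 0)
          (fun s hs => (hd s hs).continuousWithinAt)
          (fun s hs => (hd s (interior_subset hs)).mono interior_subset) fun s hs => ?_
        have h1 := hC _ (hymem s (interior_subset hs))
        have h2 : 0 ≤ C * (y s - r) + f (y s) := by linarith
        have := mul_nonneg (Real.exp_pos (C * s)).le h2
        linarith
      have h1 := hm self_mem_Ici ht ht
      simp only [mul_zero, Real.exp_zero, one_mul, hy0] at h1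
      have h2 := (mul_pos_iff_of_pos_left (Real.exp_pos _)).1 (hr'.trans_le h1)
      linarith
    set x : ℝ → ℝ := fun s => -Real.log ((y s - r) / (1 - r)) with hx
    have hex : ∀ s, 0 ≤ s → e (x s) = y s := fun s hs => by
      have : 0 < (y s - r) / (1 - r) := div_pos (sub_pos.2 (hyr s hs)) hr'
      simp only [he, hx, neg_neg, Real.exp_log this]
      field_simp
      ring
    have hx0 : ∀ s, 0 ≤ s → 0 ≤ x s := fun s hs => by
      have : (y s - r) / (1 - r) ≤ 1 := by
        rw [div_le_one hr']; have := (hymem s hs).2; linarith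
      exact neg_nonneg.2 (Real.log_nonpos (div_nonneg (sub_pos.2 (hyr s hs)).le hr'.le) this)
    have hxd : ∀ s, 0 ≤ s → HasDerivWithinAt x (h (x s)) (Ici 0) s := fun s hs => by
      have hys := sub_pos.2 (hyr s hs)
      have hd := ((((hyder s hs).sub_const r).div_const (1 - r)).log
        (div_pos hys hr').ne').neg
      convert! hd using 1
      simp only [hh, max_eq_left (hx0 s hs), hex s hs]
      field_simp
    have hSx : ∀ s, 0 ≤ s → HasDerivWithinAt (fun s => S (x s) - s) 0 (Ici 0) s := fun s hs => by
      have := ((hSder (x s)).comp_hasDerivWithinAt s (hxd s hs)).sub (hasDerivWithinAt_id s (Ici 0))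
      rwa [inv_mul_cancel₀ (hh_pos _).ne', sub_self] at this
    have hconst := constant_of_has_deriv_right_zero (a := 0) (b := t) (f := fun s => S (x s) - s)
      (fun s hs => (hSx s hs.1).continuousWithinAt.mono Icc_subset_Ici_self)
      (fun s hs => (hSx s hs.1).mono (Ici_subset_Ici.2 hs.1)) t ⟨ht, le_rfl⟩
    have hx00 : x 0 = 0 := by simp [hx, hy0, div_self hr'.ne']
    simp only [hx00, hS0, sub_zero, sub_eq_zero] at hconst
    show y t = e (S.symm t)
    rw [← hex t ht, ← hconst, S.symm_apply_apply, hconst]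
  · have h1 : Tendsto e atTop (𝓝 (r + (1 - r) * 0)) :=
      (Real.tendsto_exp_neg_atTop_nhds_zero.const_mul _).const_add _
    rw [mul_zero, add_zero] at h1
    exact h1.comp S.symm.tendsto_atTop

/-! ### The generating function as a solution of the flow equation -/

theorem IsBranchingRates.exists_flow_of_ne_one {b : ℕ → ℝ} {N : Finset ℕ} {v : N → ℝ}
    (hb : IsBranchingRates b) (hN1 : 1 ∉ N) (hNpos : ∀ k ∈ N, 0 < b k)
    (hv : ∀ k, v k ∈ Icc (0 : ℝ) 1) {k : N} (hk : v k ≠ 1) :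
    ∃ G : ℝ → ℝ, IsFlow b N v 1 G ∧ (∀ y, IsFlow b N v 1 y → ∀ t, 0 ≤ t → y t = G t) ∧
      Tendsto G atTop (𝓝 (rhoN b N v)) := by
  have hneg := hb.tsum_marked_neg hN1 hNpos hv hk
  have hsum := hb.summable_abs_marked hv
  have hroot := (hb.isLeast_rhoN hN1 hv).1
  rw [hb.rootsBN_eq] at hroot
  have hr1 : rhoN b N v < 1 := by
    refine lt_of_le_of_ne hroot.1.2 fun h => ?_
    have := hroot.2
    simp only [h, markedGen, one_pow, mul_one] at this
    exact hneg.ne this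
  obtain ⟨s, hs⟩ := exists_tangent_le_tsum hsum (hb.marked_nonneg hv) hroot.1.1 hr1
  obtain ⟨G, ⟨hG0, hGm, hGd⟩, huniq, hlim⟩ := exists_unique_descending_solution
    (f := markedGen b N v) (C := -s) (continuousOn_tsum_mul_pow hsum) hroot.1.1 hr1
    (fun u hu hu1 => tsum_neg_of_root_lt hsum (hb.marked_nonneg hv) hneg hroot.1 hroot.2 hu hu1)
    (fun u hu => by
      have h1 := hs u hu
      have h2 : (∑' j, b j * markFactor v j * rhoN b N v ^ j) = 0 := hroot.2
      rw [h2, zero_add] at h1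
      rwa [neg_neg])
  refine ⟨G, ⟨hG0, hGm, fun t ht => ?_⟩, fun y hy => huniq y hy.init hy.mem fun t ht => ?_, hlim⟩
  · rw [add_comm, hb.genBbar_add_genBN (hGm t ht)]; exact hGd t ht
  · rw [← hb.genBbar_add_genBN (hy.mem t ht), add_comm]; exact hy.deriv t ht

/-- If `1` is the least root, the field is nonnegative on `[0, 1]`, and the solution starting at `1`
cannot leave `1`. -/
theorem IsBranchingRates.exists_flow_of_rhoN_eq_one {b : ℕ → ℝ} {N : Finset ℕ} {v : N → ℝ}
    (hb : IsBranchingRates b) (hN1 : 1 ∉ N) (hv : ∀ k, v k ∈ Icc (0 : ℝ) 1)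
    (h1 : rhoN b N v = 1) :
    ∃ G : ℝ → ℝ, IsFlow b N v 1 G ∧ (∀ y, IsFlow b N v 1 y → ∀ t, 0 ≤ t → y t = G t) ∧
      Tendsto G atTop (𝓝 (rhoN b N v)) := by
  have hroot := hb.isLeast_rhoN hN1 hv
  rw [hb.rootsBN_eq, h1] at hroot
  have hnn : ∀ u ∈ Icc (0 : ℝ) 1, 0 ≤ markedGen b N v u := fun u hu => by
    rcases hu.2.eq_or_lt with rfl | hlt
    · exact hroot.1.2.ge
    · exact (tsum_pos_of_lt_least_root (hb.summable_abs_marked hv)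
        (hb.marked_nonneg hv 0 zero_ne_one) hroot hu.1 hlt).le
  refine ⟨fun _ => 1, ⟨rfl, fun t _ => ⟨zero_le_one, le_rfl⟩, fun t _ => ?_⟩,
    fun y hy t ht => le_antisymm (hy.mem t ht).2 ?_, by rw [h1]; exact tendsto_const_nhds⟩
  · have h0 : genBbar b N 1 + genBN b N 1 v = 0 := by
      rw [hb.genBbar_add_genBN ⟨zero_le_one, le_rfl⟩]; exact hroot.1.2
    rw [add_comm, h0]
    exact hasDerivWithinAt_const _ _ _
  · have hm : MonotoneOn y (Ici 0) := by
      refine monotoneOn_of_hasDerivWithinAt_nonneg (convex_Ici 0)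
        (fun s hs => (hy.deriv s hs).continuousWithinAt)
        (fun s hs => (hy.deriv s (interior_subset hs)).mono interior_subset) fun s hs => ?_
      rw [add_comm, hb.genBbar_add_genBN (hy.mem s (interior_subset hs))]
      exact hnn _ (hy.mem s (interior_subset hs))
    have := hm self_mem_Ici ht ht
    rwa [hy.init] at this

/-! ### Rows of the `Q`-matrix -/

section Rows

variable {b : ℕ → ℝ} {N : Finset ℕ} {v : N → ℝ} {u : ℝ}

/-- The monomial `u ^ j * ∏ k, v k ^ l k` attached to the state `(j, l)`. -/
noncomputable def stateMonomial (u : ℝ) (v : N → ℝ) (z : CrossState N) : ℝ :=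
  u ^ z.1 * ∏ k, v k ^ z.2 k

/-- The state reached from `y` when a particle is replaced by `m` particles (for `y.1 ≥ 1`, so that
the truncated subtraction is the true one). -/
def crossJump (y : CrossState N) (m : ℕ) : CrossState N :=
  (y.1 + m - 1, fun n => y.2 n + if (n : ℕ) = m then 1 else 0)

theorem prod_pow_mem (hv : ∀ k, v k ∈ Icc (0 : ℝ) 1) (l : N → ℕ) :
    ∏ k, v k ^ l k ∈ Icc (0 : ℝ) 1 :=
  ⟨Finset.prod_nonneg fun k _ => pow_nonneg (hv k).1 _,
    Finset.prod_le_one (fun k _ => pow_nonneg (hv k).1 _) fun k _ => pow_le_one₀ (hv k).1 (hv k).2⟩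

theorem stateMonomial_mem (hu : u ∈ Icc (0 : ℝ) 1) (hv : ∀ k, v k ∈ Icc (0 : ℝ) 1)
    (z : CrossState N) : stateMonomial u v z ∈ Icc (0 : ℝ) 1 := by
  have h := prod_pow_mem hv z.2
  exact ⟨mul_nonneg (pow_nonneg hu.1 _) h.1, mul_le_one₀ (pow_le_one₀ hu.1 hu.2) h.1 h.2⟩

theorem stateMonomial_crossJump {y : CrossState N} (hy : 1 ≤ y.1) (m : ℕ) :
    stateMonomial u v (crossJump y m) =
      u ^ (y.1 - 1) * (∏ k, v k ^ y.2 k) * (markFactor v m * u ^ m) := by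
  have h1 : ∏ k : N, v k ^ (if (k : ℕ) = m then 1 else 0) = markFactor v m := by
    unfold markFactor
    split_ifs with h
    · rw [Finset.prod_eq_single ⟨m, h⟩]
      · simp
      · intro k _ hk
        rw [if_neg (fun h' => hk (Subtype.ext h')), pow_zero]
      · simp
    · refine Finset.prod_eq_one fun k _ => ?_
      rw [if_neg (by rintro rfl; exact h k.2), pow_zero]
  have h2 : y.1 + m - 1 = (y.1 - 1) + m := by omega
  simp only [stateMonomial, crossJump, pow_add, Finset.prod_mul_distrib, h1, h2]
  ring

theorem crossingQ_crossJump {y : CrossState N} (hy : 1 ≤ y.1) (m : ℕ) :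
    crossingQ b N y (crossJump y m) = y.1 * b m := by
  have h : y.1 + m - 1 + 1 - y.1 = m := by omega
  have h' : y.1 ≤ y.1 + m - 1 + 1 := by omega
  simp [crossingQ, crossJump, h, hy, h']

theorem crossingQ_eq_zero_of_notMem_range {y z : CrossState N} (hz : z ∉ range (crossJump y)) :
    crossingQ b N y z = 0 := by
  refine if_neg fun h => hz ⟨z.1 + 1 - y.1, Prod.ext ?_ (funext fun n => (h.2.2 n).symm)⟩
  simp only [crossJump]
  omega

theorem crossingQ_of_fst_eq_zero {y : CrossState N} (hy : y.1 = 0) (z : CrossState N) :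
    crossingQ b N y z = 0 := by
  simp [crossingQ, hy]

/-- A sum over a row of the `Q`-matrix is a sum over the numbers of offspring. -/
theorem hasSum_row {F : ℝ → ℝ} (hF : F 0 = 0) {y : CrossState N} (hy : 1 ≤ y.1) {a : ℝ}
    (h : HasSum (fun m => F (y.1 * b m) * (markFactor v m * u ^ m)) a) :
    HasSum (fun z => F (crossingQ b N y z) * stateMonomial u v z)
      (u ^ (y.1 - 1) * (∏ k, v k ^ y.2 k) * a) := by
  have hinj : Function.Injective (crossJump y) := fun m n hmn => by
    have := congrArg Prod.fst hmn
    simp only [crossJump] at this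
    omega
  refine (hinj.hasSum_iff fun z hz => ?_).1 ?_
  · rw [crossingQ_eq_zero_of_notMem_range hz, hF, zero_mul]
  · refine (h.mul_left _).congr_fun fun m => ?_
    simp only [Function.comp, crossingQ_crossJump hy, stateMonomial_crossJump hy]
    ring

/-- The generator applied to a monomial: `Q (uʲ vˡ) = (B̄_N(u) + B_N(u, v)) ∂ᵤ(uʲ vˡ)`. -/
theorem hasSum_crossingQ_mul (hb : IsBranchingRates b) (hu : u ∈ Icc (0 : ℝ) 1)
    (hv : ∀ k, v k ∈ Icc (0 : ℝ) 1) (y : CrossState N) :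
    HasSum (fun z => crossingQ b N y z * stateMonomial u v z)
      (markedGen b N v u * (y.1 * u ^ (y.1 - 1) * ∏ k, v k ^ y.2 k)) := by
  rcases Nat.eq_zero_or_pos y.1 with hy | hy
  · simp [crossingQ_of_fst_eq_zero hy, hy]
  · have h := (summable_mul_pow (hb.summable_abs_marked hv) hu).hasSum.mul_left (y.1 : ℝ)
    have h2 := hasSum_row (b := b) (v := v) (u := u) (F := id) rfl hy
      (h.congr_fun fun m => by simp only [id]; ring)
    convert! h2 using 1
    rw [markedGen]; ring

theorem summable_abs_crossingQ_mul (hb : IsBranchingRates b) (hu0 : 0 ≤ u) (hu1 : u < 1)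
    (hv : ∀ k, v k ∈ Icc (0 : ℝ) 1) (y : CrossState N) :
    Summable (fun z => |crossingQ b N y z| * stateMonomial u v z) ∧
      ∑' z, |crossingQ b N y z| * stateMonomial u v z ≤ (1 - u)⁻¹ * ∑' m, |b m| := by
  have hK : 0 ≤ ∑' m, |b m| := tsum_nonneg fun m => abs_nonneg _
  have hinv : 0 ≤ (1 - u)⁻¹ := inv_nonneg.2 (by linarith)
  rcases Nat.eq_zero_or_pos y.1 with hy | hy
  · simp [crossingQ_of_fst_eq_zero hy, mul_nonneg hinv hK]
  · have hle : ∀ m, |b m| * (markFactor v m * u ^ m) ≤ |b m| := fun m =>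
      mul_le_of_le_one_right (abs_nonneg _) (mul_le_one₀ (markFactor_mem hv m).2
        (pow_nonneg hu0 _) (pow_le_one₀ hu0 hu1.le))
    have hs : Summable fun m => |b m| * (markFactor v m * u ^ m) :=
      hb.summable_abs.of_nonneg_of_le (fun m => mul_nonneg (abs_nonneg _)
        (mul_nonneg (markFactor_mem hv m).1 (pow_nonneg hu0 _))) hle
    have h2 := hasSum_row (b := b) (v := v) (u := u) (F := fun a => |a|) abs_zero hy
      ((hs.hasSum.mul_left (y.1 : ℝ)).congr_fun fun m => by
        rw [abs_mul, Nat.abs_cast, mul_assoc])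
    refine ⟨h2.summable, h2.tsum_eq.trans_le ?_⟩
    have h3 : ∑' m, |b m| * (markFactor v m * u ^ m) ≤ ∑' m, |b m| :=
      hs.tsum_le_tsum hle hb.summable_abs
    have h4 := prod_pow_mem hv y.2
    have h5 := nat_mul_pow_pred_le hu0 hu1 y.1
    have h6 : 0 ≤ ∑' m, |b m| * (markFactor v m * u ^ m) := tsum_nonneg fun m =>
      mul_nonneg (abs_nonneg _) (mul_nonneg (markFactor_mem hv m).1 (pow_nonneg hu0 _))
    have h7 : (y.1 : ℝ) * u ^ (y.1 - 1) * ∏ k, v k ^ y.2 k ≤ (1 - u)⁻¹ :=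
      (mul_le_of_le_one_right (by positivity) h4.2).trans h5
    calc _ = (y.1 * u ^ (y.1 - 1) * ∏ k, v k ^ y.2 k) *
          ∑' m, |b m| * (markFactor v m * u ^ m) := by ring
      _ ≤ (1 - u)⁻¹ * ∑' m, |b m| := mul_le_mul h7 h3 h6 hinv

theorem abs_crossingQ_le (hb : IsBranchingRates b) (y z : CrossState N) :
    |crossingQ b N y z| ≤ (z.1 + 1) * -b 1 := by
  have h1 := neg_pos.2 hb.neg_one
  unfold crossingQ
  split_ifs with h
  · rw [abs_mul, Nat.abs_cast]
    exact mul_le_mul (by exact_mod_cast h.2.1) (hb.abs_le _) (abs_nonneg _) (by positivity)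
  · rw [abs_zero]; positivity

end Rows

/-! ### Generating functions of the transition probabilities -/

section StateGen

variable {b : ℕ → ℝ} {N : Finset ℕ} {v : N → ℝ} {u : ℝ}
  {p : ℝ → CrossState N → CrossState N → ℝ} {x : CrossState N}

/-- `E_x[u ^ X(t) * ∏ k, v k ^ Y_k(t)]`, computed from the transition function. -/
noncomputable def stateGen (p : ℝ → CrossState N → CrossState N → ℝ) (x : CrossState N)
    (v : N → ℝ) (u t : ℝ) : ℝ :=
  ∑' z, p t x z * stateMonomial u v z

/-- `∂ᵤ E_x[u ^ X(t) * ∏ k, v k ^ Y_k(t)]`, computed term by term. -/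
noncomputable def stateGenDeriv (p : ℝ → CrossState N → CrossState N → ℝ) (x : CrossState N)
    (v : N → ℝ) (u t : ℝ) : ℝ :=
  ∑' y, p t x y * (y.1 * u ^ (y.1 - 1) * ∏ k, v k ^ y.2 k)

namespace IsTransitionFunction

theorem summable_mul_of_bdd (hp : IsTransitionFunction p) {t : ℝ} (ht : 0 ≤ t)
    {g : CrossState N → ℝ} {C : ℝ} (hg : ∀ z, |g z| ≤ C) : Summable fun z => p t x z * g z :=
  Summable.of_norm_bounded ((hp.honest t ht x).summable.mul_right C) fun z => by
    rw [Real.norm_eq_abs, abs_mul, abs_of_nonneg (hp.nonneg t ht x z)]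
    exact mul_le_mul_of_nonneg_left (hg z) (hp.nonneg t ht x z)

theorem tsum_mul_le (hp : IsTransitionFunction p) {t : ℝ} (ht : 0 ≤ t)
    {g : CrossState N → ℝ} {C : ℝ} (h0 : ∀ z, 0 ≤ g z) (hg : ∀ z, g z ≤ C) :
    ∑' z, p t x z * g z ≤ C := by
  have h := hp.honest t ht x
  calc ∑' z, p t x z * g z ≤ ∑' z, p t x z * C :=
        (hp.summable_mul_of_bdd ht fun z => (abs_of_nonneg (h0 z)).trans_le (hg z)).tsum_le_tsum
          (fun z => mul_le_mul_of_nonneg_left (hg z) (hp.nonneg t ht x z)) (h.summable.mul_right C)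
    _ = C := by rw [tsum_mul_right, h.tsum_eq, one_mul]

theorem summable_stateGen (hp : IsTransitionFunction p) (hu : u ∈ Icc (0 : ℝ) 1)
    (hv : ∀ k, v k ∈ Icc (0 : ℝ) 1) {t : ℝ} (ht : 0 ≤ t) :
    Summable fun z => p t x z * stateMonomial u v z :=
  hp.summable_mul_of_bdd (C := 1) ht fun z => by
    rw [abs_of_nonneg (stateMonomial_mem hu hv z).1]; exact (stateMonomial_mem hu hv z).2

theorem stateGen_mem (hp : IsTransitionFunction p) (hu : u ∈ Icc (0 : ℝ) 1)
    (hv : ∀ k, v k ∈ Icc (0 : ℝ) 1) {t : ℝ} (ht : 0 ≤ t) :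
    stateGen p x v u t ∈ Icc (0 : ℝ) 1 :=
  ⟨tsum_nonneg fun z => mul_nonneg (hp.nonneg t ht x z) (stateMonomial_mem hu hv z).1,
    hp.tsum_mul_le ht (fun z => (stateMonomial_mem hu hv z).1)
      fun z => (stateMonomial_mem hu hv z).2⟩

theorem stateGen_zero (hp : IsTransitionFunction p) :
    stateGen p x v u 0 = stateMonomial u v x := by
  rw [stateGen, tsum_eq_single x]
  · simp [hp.zero]
  · intro z hz
    simp [hp.zero, hz.symm]

theorem deriv_weight_mem (hu0 : 0 ≤ u) (hu1 : u < 1) (hv : ∀ k, v k ∈ Icc (0 : ℝ) 1)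
    (y : CrossState N) :
    (y.1 * u ^ (y.1 - 1) * ∏ k, v k ^ y.2 k) ∈ Icc 0 (1 - u)⁻¹ := by
  have h := prod_pow_mem hv y.2
  exact ⟨mul_nonneg (by positivity) h.1,
    (mul_le_of_le_one_right (by positivity) h.2).trans (nat_mul_pow_pred_le hu0 hu1 _)⟩

theorem summable_stateGenDeriv (hp : IsTransitionFunction p) (hu0 : 0 ≤ u) (hu1 : u < 1)
    (hv : ∀ k, v k ∈ Icc (0 : ℝ) 1) {t : ℝ} (ht : 0 ≤ t) :
    Summable fun y => p t x y * (y.1 * u ^ (y.1 - 1) * ∏ k, v k ^ y.2 k) :=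
  hp.summable_mul_of_bdd ht fun y => by
    rw [abs_of_nonneg (deriv_weight_mem hu0 hu1 hv y).1]; exact (deriv_weight_mem hu0 hu1 hv y).2

theorem stateGenDeriv_mem (hp : IsTransitionFunction p) (hu0 : 0 ≤ u) (hu1 : u < 1)
    (hv : ∀ k, v k ∈ Icc (0 : ℝ) 1) {t : ℝ} (ht : 0 ≤ t) :
    stateGenDeriv p x v u t ∈ Icc 0 (1 - u)⁻¹ :=
  ⟨tsum_nonneg fun z => mul_nonneg (hp.nonneg t ht x z) (deriv_weight_mem hu0 hu1 hv z).1,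
    hp.tsum_mul_le ht (fun z => (deriv_weight_mem hu0 hu1 hv z).1)
      fun z => (deriv_weight_mem hu0 hu1 hv z).2⟩

/-- The weight of the living states is at most the derivative in `u`, as `uʲ ≤ j uʲ⁻¹` for
`j ≥ 1`. -/
theorem stateGen_sub_le_stateGenDeriv (hp : IsTransitionFunction p) (hu0 : 0 ≤ u) (hu1 : u < 1)
    (hv : ∀ k, v k ∈ Icc (0 : ℝ) 1) {t : ℝ} (ht : 0 ≤ t) :
    stateGen p x v u t - stateGen p x v 0 t ≤ stateGenDeriv p x v u t := by
  have h1 := hp.summable_stateGen (x := x) (u := u) ⟨hu0, hu1.le⟩ hv ht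
  have h2 := hp.summable_stateGen (x := x) (u := 0) ⟨le_rfl, zero_le_one⟩ hv ht
  rw [stateGen, stateGen, ← h1.tsum_sub h2]
  refine (h1.sub h2).tsum_le_tsum (fun z => ?_) (hp.summable_stateGenDeriv hu0 hu1 hv ht)
  rw [← mul_sub]
  refine mul_le_mul_of_nonneg_left ?_ (hp.nonneg t ht x z)
  rw [stateMonomial, stateMonomial, ← sub_mul]
  refine mul_le_mul_of_nonneg_right ?_ (prod_pow_mem hv z.2).1
  rcases Nat.eq_zero_or_pos z.1 with hz | hz
  · simp [hz]
  · obtain ⟨m, hm⟩ : ∃ m, z.1 = m + 1 := ⟨z.1 - 1, by omega⟩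
    rw [hm, zero_pow m.succ_ne_zero, sub_zero, pow_succ, Nat.add_sub_cancel]
    have h3 : (0 : ℝ) ≤ u ^ m := pow_nonneg hu0 m
    have h4 : u ^ m * u ≤ u ^ m := mul_le_of_le_one_right h3 hu1.le
    have h5 : (0 : ℝ) ≤ m * u ^ m := by positivity
    push_cast
    linarith

theorem stateGen_mono (hp : IsTransitionFunction p) {u' : ℝ} (hu0 : 0 ≤ u) (hu : u ≤ u')
    (hu1 : u' ≤ 1) (hv : ∀ k, v k ∈ Icc (0 : ℝ) 1) {t : ℝ} (ht : 0 ≤ t) :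
    stateGen p x v u t ≤ stateGen p x v u' t :=
  (hp.summable_stateGen ⟨hu0, hu.trans hu1⟩ hv ht).tsum_le_tsum
    (fun z => mul_le_mul_of_nonneg_left (mul_le_mul_of_nonneg_right (pow_le_pow_left₀ hu0 hu _)
      (prod_pow_mem hv z.2).1) (hp.nonneg t ht x z))
    (hp.summable_stateGen ⟨hu0.trans hu, hu1⟩ hv ht)

end IsTransitionFunction

theorem ForwardEquation.continuousOn (hfwd : ForwardEquation p (crossingQ b N))
    (x z : CrossState N) : ContinuousOn (fun s => p s x z) (Ici 0) :=
  fun s hs => (hfwd x z s hs).2.continuousWithinAt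

theorem aemeasurable_transition (hfwd : ForwardEquation p (crossingQ b N)) {s t : ℝ} (hs : 0 ≤ s)
    (x z : CrossState N) : AEMeasurable (fun σ => p σ x z) (volume.restrict (Ioc s t)) :=
  ((hfwd.continuousOn x z).mono fun _ h => hs.trans h.1.le).aemeasurable measurableSet_Ioc

theorem intervalIntegrable_stateGenDeriv (hp : IsTransitionFunction p)
    (hfwd : ForwardEquation p (crossingQ b N)) (hu0 : 0 ≤ u) (hu1 : u < 1)
    (hv : ∀ k, v k ∈ Icc (0 : ℝ) 1) {s t : ℝ} (hs : 0 ≤ s) (hst : s ≤ t) :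
    IntervalIntegrable (stateGenDeriv p x v u) volume s t := by
  rw [intervalIntegrable_iff_integrableOn_Ioc_of_le hst]
  refine IntegrableOn.of_bound measure_Ioc_lt_top ?_ (1 - u)⁻¹ ?_
  · exact (AEMeasurable.tsum (L := SummationFilter.unconditional _) fun y =>
      (aemeasurable_transition hfwd hs x y).mul_const _).aestronglyMeasurable
  · refine (ae_restrict_iff' measurableSet_Ioc).2 (Eventually.of_forall fun σ hσ => ?_)
    have h := hp.stateGenDeriv_mem (x := x) hu0 hu1 hv (hs.trans hσ.1.le)
    rw [Real.norm_eq_abs, abs_of_nonneg h.1]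
    exact h.2

/-- The double series `∑ p_{xy} q_{yz} uʲ vˡ` over `y` and `z = (j, l)` converges absolutely, with
a bound that does not depend on time. -/
theorem summable_flux (hb : IsBranchingRates b) (hp : IsTransitionFunction p) (hu0 : 0 ≤ u)
    (hu1 : u < 1) (hv : ∀ k, v k ∈ Icc (0 : ℝ) 1) {t : ℝ} (ht : 0 ≤ t) :
    Summable (Function.uncurry fun y z => p t x y * (|crossingQ b N y z| * stateMonomial u v z)) ∧
    ∑' z, ∑' y, p t x y * (|crossingQ b N y z| * stateMonomial u v z) ≤
      (1 - u)⁻¹ * ∑' m, |b m| := by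
  have hu : u ∈ Icc (0 : ℝ) 1 := ⟨hu0, hu1.le⟩
  have hrow := summable_abs_crossingQ_mul (N := N) hb hu0 hu1 hv
  have hrow0 : ∀ y : CrossState N, 0 ≤ ∑' z, |crossingQ b N y z| * stateMonomial u v z :=
    fun y => tsum_nonneg fun z => mul_nonneg (abs_nonneg _) (stateMonomial_mem hu hv z).1
  have hs : Summable
      (Function.uncurry fun y z => p t x y * (|crossingQ b N y z| * stateMonomial u v z)) := by
    refine (summable_prod_of_nonneg fun yz => ?_).2 ⟨fun y => ?_, ?_⟩
    · exact mul_nonneg (hp.nonneg t ht x _)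
        (mul_nonneg (abs_nonneg _) (stateMonomial_mem hu hv _).1)
    · exact Summable.mul_left (p t x y) (hrow y).1
    · simp only [Function.uncurry, tsum_mul_left]
      exact hp.summable_mul_of_bdd (x := x)
        (g := fun y => ∑' z, |crossingQ b N y z| * stateMonomial u v z) ht
        fun y => (abs_of_nonneg (hrow0 y)).trans_le (hrow y).2
  refine ⟨hs, ?_⟩
  rw [hs.tsum_comm]
  simp only [tsum_mul_left]
  exact hp.tsum_mul_le (g := fun y => ∑' z, |crossingQ b N y z| * stateMonomial u v z) ht hrow0
    fun y => (hrow y).2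

theorem tsum_forward_mul (hb : IsBranchingRates b) (hp : IsTransitionFunction p) (hu0 : 0 ≤ u)
    (hu1 : u < 1) (hv : ∀ k, v k ∈ Icc (0 : ℝ) 1) {t : ℝ} (ht : 0 ≤ t) :
    ∑' z, (∑' y, p t x y * crossingQ b N y z) * stateMonomial u v z =
      markedGen b N v u * stateGenDeriv p x v u t := by
  have hu : u ∈ Icc (0 : ℝ) 1 := ⟨hu0, hu1.le⟩
  have hs : Summable
      (Function.uncurry fun y z => p t x y * (crossingQ b N y z * stateMonomial u v z)) := by
    refine Summable.of_abs ((summable_flux hb hp (x := x) hu0 hu1 hv ht).1.congr fun yz => ?_)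
    simp only [Function.uncurry, abs_mul, abs_of_nonneg (hp.nonneg t ht x yz.1),
      abs_of_nonneg (stateMonomial_mem hu hv yz.2).1]
  have h1 : ∀ z, (∑' y, p t x y * crossingQ b N y z) * stateMonomial u v z =
      ∑' y, p t x y * (crossingQ b N y z * stateMonomial u v z) := fun z => by
    rw [← tsum_mul_right]
    simp only [mul_assoc]
  simp only [h1]
  rw [hs.tsum_comm, stateGenDeriv, ← tsum_mul_left]
  refine tsum_congr fun y => ?_
  rw [tsum_mul_left, (hasSum_crossingQ_mul hb hu hv y).tsum_eq]
  ring

/-- The integrated Kolmogorov equation for a monomial: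
`stateGen` changes at the rate `(B̄_N(u) + B_N(u, v)) * stateGenDeriv`. -/
theorem stateGen_sub_eq_integral (hb : IsBranchingRates b) (hp : IsTransitionFunction p)
    (hfwd : ForwardEquation p (crossingQ b N)) (hu0 : 0 ≤ u) (hu1 : u < 1)
    (hv : ∀ k, v k ∈ Icc (0 : ℝ) 1) {s t : ℝ} (hs : 0 ≤ s) (hst : s ≤ t) :
    stateGen p x v u t - stateGen p x v u s =
      markedGen b N v u * ∫ σ in s..t, stateGenDeriv p x v u σ := by
  have hu : u ∈ Icc (0 : ℝ) 1 := ⟨hu0, hu1.le⟩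
  set a : CrossState N → ℝ → ℝ := fun z σ => ∑' y, p σ x y * crossingQ b N y z with ha
  have hpos : ∀ σ ∈ Ioc s t, 0 < σ := fun σ hσ => hs.trans_lt hσ.1
  have hameas : ∀ z, AEStronglyMeasurable (a z) (volume.restrict (Ioc s t)) := fun z =>
    (AEMeasurable.tsum (L := SummationFilter.unconditional _) fun y =>
      (aemeasurable_transition hfwd hs x y).mul_const _).aestronglyMeasurable
  have haint : ∀ z, IntegrableOn (a z) (Ioc s t) := fun z => by
    refine IntegrableOn.of_bound measure_Ioc_lt_top (hameas z) ((z.1 + 1) * -b 1)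
      ((ae_restrict_iff' measurableSet_Ioc).2 (Eventually.of_forall fun σ hσ => ?_))
    have hσ0 := (hpos σ hσ).le
    have h1 := hp.summable_mul_of_bdd (x := x) hσ0 (g := fun y => |crossingQ b N y z|)
      fun y => (abs_abs _).trans_le (abs_crossingQ_le hb y z)
    refine (norm_tsum_le_tsum_norm (h1.congr fun y => ?_)).trans
      ((tsum_congr fun y => ?_).trans_le (hp.tsum_mul_le (x := x) hσ0 (fun y => abs_nonneg _)
        fun y => abs_crossingQ_le hb y z)) <;>
    rw [Real.norm_eq_abs, abs_mul, abs_of_nonneg (hp.nonneg σ hσ0 x y)]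
  have hftc : ∀ z, ∫ σ in Ioc s t, a z σ = p t x z - p s x z := fun z => by
    rw [← intervalIntegral.integral_of_le hst]
    exact intervalIntegral.integral_eq_sub_of_hasDerivAt_of_le hst
      ((hfwd.continuousOn x z).mono fun _ h => hs.trans h.1)
      (fun σ hσ => (hfwd x z σ (hs.trans hσ.1.le)).2.hasDerivAt
        (Ici_mem_nhds (hs.trans_lt hσ.1)))
      ((intervalIntegrable_iff_integrableOn_Ioc_of_le hst).2 (haint z))
  have hswap : ∫ σ in Ioc s t, ∑' z, a z σ * stateMonomial u v z =
      ∑' z, ∫ σ in Ioc s t, a z σ * stateMonomial u v z := by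
    refine integral_tsum (fun z => (hameas z).mul_const _) ?_
    rw [← lintegral_tsum fun z => ((hameas z).mul_const _).enorm]
    refine ne_of_lt (lt_of_le_of_lt (setLIntegral_mono_ae measurable_const.aemeasurable
      (g := fun _ => ENNReal.ofReal ((1 - u)⁻¹ * ∑' m, |b m|))
      (Eventually.of_forall fun σ hσ => ?_)) ?_)
    · have hσ0 := (hpos σ hσ).le
      obtain ⟨hf1, hf2⟩ := summable_flux hb hp (x := x) hu0 hu1 hv hσ0
      have hz : ∀ z, ‖a z σ * stateMonomial u v z‖ ≤
          ∑' y, p σ x y * (|crossingQ b N y z| * stateMonomial u v z) := fun z => by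
        have h1 : Summable fun y => p σ x y * (|crossingQ b N y z| * stateMonomial u v z) :=
          hf1.prod_symm.prod_factor z
        rw [ha, ← tsum_mul_right]
        refine (norm_tsum_le_tsum_norm (h1.congr fun y => ?_)).trans
          (tsum_congr fun y => ?_).le <;>
        rw [Real.norm_eq_abs, abs_mul, abs_mul, abs_of_nonneg (hp.nonneg σ hσ0 x y),
          abs_of_nonneg (stateMonomial_mem hu hv z).1, mul_assoc]
      have hsz : Summable fun z => ∑' y, p σ x y * (|crossingQ b N y z| * stateMonomial u v z) :=
        hf1.prod_symm.prod
      have hsn := hsz.of_nonneg_of_le (fun z => norm_nonneg _) hz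
      simp only [← ofReal_norm]
      rw [← ENNReal.ofReal_tsum_of_nonneg (fun z => norm_nonneg _) hsn]
      exact ENNReal.ofReal_le_ofReal ((hsn.tsum_le_tsum hz hsz).trans hf2)
    · rw [setLIntegral_const]
      exact ENNReal.mul_lt_top ENNReal.ofReal_lt_top measure_Ioc_lt_top
  have ht := hs.trans hst
  rw [stateGen, stateGen,
    ← (hp.summable_stateGen hu hv ht).tsum_sub (hp.summable_stateGen hu hv hs)]
  calc ∑' z, (p t x z * stateMonomial u v z - p s x z * stateMonomial u v z)
      = ∑' z, ∫ σ in Ioc s t, a z σ * stateMonomial u v z := by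
        refine tsum_congr fun z => ?_
        rw [integral_mul_const, hftc, sub_mul]
    _ = ∫ σ in Ioc s t, markedGen b N v u * stateGenDeriv p x v u σ := by
        rw [← hswap]
        exact setIntegral_congr_fun measurableSet_Ioc fun σ hσ =>
          tsum_forward_mul hb hp hu0 hu1 hv (hpos σ hσ).le
    _ = _ := by rw [integral_const_mul, intervalIntegral.integral_of_le hst]

end StateGen

/-! ### Monotonicity in time and the limit at infinity -/

section Longtime

variable {b : ℕ → ℝ} {N : Finset ℕ} {v : N → ℝ} {u : ℝ}
  {p : ℝ → CrossState N → CrossState N → ℝ} {x : CrossState N}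

theorem monotoneOn_stateGen (hb : IsBranchingRates b) (hp : IsTransitionFunction p)
    (hfwd : ForwardEquation p (crossingQ b N)) (hu0 : 0 ≤ u) (hu1 : u < 1)
    (hv : ∀ k, v k ∈ Icc (0 : ℝ) 1) (h : 0 ≤ markedGen b N v u) :
    MonotoneOn (stateGen p x v u) (Ici 0) := by
  intro s hs t _ hst
  rw [← sub_nonneg, stateGen_sub_eq_integral hb hp hfwd hu0 hu1 hv hs hst]
  exact mul_nonneg h (intervalIntegral.integral_nonneg hst fun σ hσ =>
    (hp.stateGenDeriv_mem hu0 hu1 hv (le_trans hs hσ.1)).1)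

theorem antitoneOn_stateGen (hb : IsBranchingRates b) (hp : IsTransitionFunction p)
    (hfwd : ForwardEquation p (crossingQ b N)) (hu0 : 0 ≤ u) (hu1 : u < 1)
    (hv : ∀ k, v k ∈ Icc (0 : ℝ) 1) (h : markedGen b N v u ≤ 0) :
    AntitoneOn (stateGen p x v u) (Ici 0) := by
  intro s hs t _ hst
  rw [← sub_nonpos, stateGen_sub_eq_integral hb hp hfwd hu0 hu1 hv hs hst]
  exact mul_nonpos_of_nonpos_of_nonneg h (intervalIntegral.integral_nonneg hst fun σ hσ =>
    (hp.stateGenDeriv_mem hu0 hu1 hv (le_trans hs hσ.1)).1)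

theorem mul_le_integral_stateGenDeriv (hp : IsTransitionFunction p)
    (hfwd : ForwardEquation p (crossingQ b N)) (hu0 : 0 ≤ u) (hu1 : u < 1)
    (hv : ∀ k, v k ∈ Icc (0 : ℝ) 1) {δ t : ℝ} (ht : 0 ≤ t)
    (h : ∀ σ ∈ Icc 0 t, δ ≤ stateGen p x v u σ - stateGen p x v 0 σ) :
    t * δ ≤ ∫ σ in (0 : ℝ)..t, stateGenDeriv p x v u σ := by
  have h1 := intervalIntegral.integral_mono_on (f := fun _ => δ) ht intervalIntegrable_const
    (intervalIntegrable_stateGenDeriv (x := x) hp hfwd hu0 hu1 hv le_rfl ht) fun σ hσ =>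
      (h σ hσ).trans (hp.stateGen_sub_le_stateGenDeriv hu0 hu1 hv hσ.1)
  simpa using h1

theorem markedGen_zero : markedGen b N v 0 = b 0 * markFactor v 0 := by
  rw [markedGen, tsum_eq_single 0 fun j hj => by simp [hj]]
  simp

theorem monotoneOn_stateGen_zero (hb : IsBranchingRates b) (hp : IsTransitionFunction p)
    (hfwd : ForwardEquation p (crossingQ b N)) (hv : ∀ k, v k ∈ Icc (0 : ℝ) 1) :
    MonotoneOn (stateGen p x v 0) (Ici 0) :=
  monotoneOn_stateGen hb hp hfwd le_rfl zero_lt_one hv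
    (markedGen_zero.symm ▸ hb.marked_nonneg hv 0 zero_ne_one)

/-- `E_{(1,0)}[∏ v_k ^ Y_k(t); X(t) = 0]` increases to the least root `r` of the field.
It stays below `r` because `E[r ^ X(t) * ∏ v_k ^ Y_k(t)]` is constant in time; it exceeds every
`w < r` because for `w < u < r` the function `E[u ^ X(t) * ∏ v_k ^ Y_k(t)]` would otherwise grow at
least linearly. -/
theorem tendsto_stateGen_zero (hb : IsBranchingRates b) (hN1 : 1 ∉ N)
    (hp : IsTransitionFunction p) (hfwd : ForwardEquation p (crossingQ b N))
    (hv : ∀ k, v k ∈ Icc (0 : ℝ) 1) :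
    Tendsto (stateGen p (1, 0) v 0) atTop (𝓝 (rhoN b N v)) := by
  have hmono := monotoneOn_stateGen_zero (x := (1, 0)) hb hp hfwd hv
  have hleast := hb.isLeast_rhoN hN1 hv
  rw [hb.rootsBN_eq] at hleast
  have hroot := hleast.1
  have hinit : ∀ u, stateGen p (1, 0) v u 0 = u := fun u => by
    simp [hp.stateGen_zero, stateMonomial]
  have hle : ∀ t, 0 ≤ t → stateGen p (1, 0) v 0 t ≤ rhoN b N v := fun t ht => by
    rcases hroot.1.2.eq_or_lt with h1 | h1
    · rw [h1]; exact (hp.stateGen_mem ⟨le_rfl, zero_le_one⟩ hv ht).2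
    · refine (hp.stateGen_mono le_rfl hroot.1.1 hroot.1.2 hv ht).trans_eq ?_
      have h2 := stateGen_sub_eq_integral (x := (1, 0)) hb hp hfwd hroot.1.1 h1 hv le_rfl ht
      rw [hroot.2, zero_mul, hinit] at h2
      linarith
  refine tendsto_order.2 ⟨fun w hw => ?_, fun w hw => ?_⟩
  · obtain ⟨t₀, ht₀, hwt⟩ : ∃ t₀, 0 ≤ t₀ ∧ w < stateGen p (1, 0) v 0 t₀ := by
      by_contra! hcon
      have hw0 : 0 ≤ w := (hp.stateGen_mem ⟨le_rfl, zero_le_one⟩ hv le_rfl).1.trans (hcon 0 le_rfl)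
      obtain ⟨u, hwu, hur⟩ := exists_between hw
      have hu0 : 0 ≤ u := hw0.trans hwu.le
      have hu1 : u < 1 := hur.trans_le hroot.1.2
      have hpos : 0 < markedGen b N v u := tsum_pos_of_lt_least_root (hb.summable_abs_marked hv)
        (hb.marked_nonneg hv 0 zero_ne_one) hleast hu0 hur
      have hmu := monotoneOn_stateGen (x := (1, 0)) hb hp hfwd hu0 hu1 hv hpos.le
      have hgrow : ∀ t, 0 ≤ t → markedGen b N v u * (t * (u - w)) ≤ 1 := fun t ht => by
        have h1 := mul_le_integral_stateGenDeriv (x := (1, 0)) hp hfwd hu0 hu1 hv ht (δ := u - w)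
          fun σ hσ => by
            have h2 := hmu self_mem_Ici hσ.1 hσ.1
            rw [hinit] at h2
            have h3 := hcon σ hσ.1
            linarith
        have h4 := stateGen_sub_eq_integral (x := (1, 0)) hb hp hfwd hu0 hu1 hv le_rfl ht
        rw [hinit] at h4
        have h5 := (hp.stateGen_mem (x := (1, 0)) ⟨hu0, hu1.le⟩ hv ht).2
        have h6 := mul_le_mul_of_nonneg_left h1 hpos.le
        linarith
      have hM : 0 < markedGen b N v u * (u - w) := mul_pos hpos (sub_pos.2 hwu)
      have h7 := hgrow (2 / (markedGen b N v u * (u - w))) (by positivity)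
      have h8 : markedGen b N v u * (2 / (markedGen b N v u * (u - w)) * (u - w)) = 2 := by
        have := hpos.ne'
        have := (sub_pos.2 hwu).ne'
        field_simp
      linarith
    filter_upwards [eventually_ge_atTop t₀] with t ht
    exact hwt.trans_le (hmono ht₀ (ht₀.trans ht) ht)
  · filter_upwards [eventually_ge_atTop 0] with t ht
    exact (hle t ht).trans_lt hw

/-- When the field is negative at `1`, so it is, uniformly, on a left neighbourhood of `1`. -/
theorem eventually_markedGen_lt (hb : IsBranchingRates b) (hN1 : 1 ∉ N)
    (hNpos : ∀ k ∈ N, 0 < b k) (hv : ∀ k, v k ∈ Icc (0 : ℝ) 1) {k : N} (hk : v k ≠ 1) :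
    ∃ c > 0, ∀ᶠ u in 𝓝[<] (1 : ℝ), 0 ≤ u ∧ u < 1 ∧ markedGen b N v u < -c := by
  have hneg := hb.tsum_marked_neg hN1 hNpos hv hk
  have h1 : markedGen b N v 1 = ∑' j, b j * markFactor v j := by simp [markedGen]
  refine ⟨-markedGen b N v 1 / 2, by rw [h1]; linarith, ?_⟩
  have hcont : ContinuousWithinAt (markedGen b N v) (Icc 0 1) 1 :=
    continuousOn_tsum_mul_pow (hb.summable_abs_marked hv) 1 ⟨zero_le_one, le_rfl⟩
  have hIco : Ico (0 : ℝ) 1 ∈ 𝓝[<] (1 : ℝ) := Ico_mem_nhdsLT zero_lt_one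
  have hle : 𝓝[<] (1 : ℝ) ≤ 𝓝[Icc 0 1] 1 :=
    nhdsWithin_le_of_mem (mem_of_superset hIco Ico_subset_Icc_self)
  filter_upwards [hIco, (hcont.mono_left hle).eventually_lt_const
    (show markedGen b N v 1 < -(-markedGen b N v 1 / 2) by rw [h1]; linarith)] with u hu hu'
  exact ⟨hu.1, hu.2, hu'⟩

theorem tendsto_stateGen_one (hp : IsTransitionFunction p) (hv : ∀ k, v k ∈ Icc (0 : ℝ) 1)
    {t : ℝ} (ht : 0 ≤ t) :
    Tendsto (fun u => stateGen p x v u t) (𝓝[<] 1) (𝓝 (stateGen p x v 1 t)) := by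
  refine tendsto_tsum_of_dominated_convergence (hp.honest t ht x).summable (fun z => ?_) ?_
  · have : Continuous fun u : ℝ => p t x z * stateMonomial u v z := by
      unfold stateMonomial; fun_prop
    exact (this.tendsto 1).mono_left nhdsWithin_le_nhds
  · filter_upwards [Ico_mem_nhdsLT (zero_lt_one : (0 : ℝ) < 1)] with u hu z
    have h := stateMonomial_mem (Ico_subset_Icc_self hu) hv z
    rw [Real.norm_eq_abs, abs_mul, abs_of_nonneg (hp.nonneg t ht x z), abs_of_nonneg h.1]
    exact mul_le_of_le_one_right (hp.nonneg t ht x z) h.2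

/-- `E[∏ v_k ^ Y_k(t); X(t) ≥ 1]` is `O(1 / t)` if some `v_k < 1`: near `u = 1` the decreasing
function `E[u ^ X(t) * ∏ v_k ^ Y_k(t)]` falls at least at the rate `c` times this expectation. -/
theorem exists_mul_stateGen_sub_le (hb : IsBranchingRates b) (hN1 : 1 ∉ N)
    (hNpos : ∀ k ∈ N, 0 < b k) (hp : IsTransitionFunction p)
    (hfwd : ForwardEquation p (crossingQ b N)) (hv : ∀ k, v k ∈ Icc (0 : ℝ) 1) {k : N}
    (hk : v k ≠ 1) (x : CrossState N) :
    ∃ c > 0, ∀ t, 0 ≤ t → c * (t * (stateGen p x v 1 t - stateGen p x v 0 t)) ≤ 1 := by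
  obtain ⟨c, hc, hev⟩ := eventually_markedGen_lt hb hN1 hNpos hv hk
  refine ⟨c, hc, fun t ht => ?_⟩
  have hlim : Tendsto (fun u => c * (t * (stateGen p x v u t - stateGen p x v 0 t))) (𝓝[<] 1)
      (𝓝 (c * (t * (stateGen p x v 1 t - stateGen p x v 0 t)))) :=
    (((tendsto_stateGen_one hp hv ht).sub_const _).const_mul t).const_mul c
  refine le_of_tendsto hlim ?_
  filter_upwards [hev] with u hu
  obtain ⟨hu0, hu1, hneg⟩ := hu
  have hanti := antitoneOn_stateGen (x := x) hb hp hfwd hu0 hu1 hv (by linarith)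
  have hmono := monotoneOn_stateGen_zero (x := x) hb hp hfwd hv
  have h1 := mul_le_integral_stateGenDeriv (x := x) hp hfwd hu0 hu1 hv ht
    (δ := stateGen p x v u t - stateGen p x v 0 t)
    fun σ hσ => sub_le_sub (hanti hσ.1 ht hσ.2) (hmono hσ.1 ht hσ.2)
  have h2 := stateGen_sub_eq_integral (x := x) hb hp hfwd hu0 hu1 hv le_rfl ht
  have h3 := (hp.stateGen_mem (x := x) ⟨hu0, hu1.le⟩ hv le_rfl).2
  have h4 := (hp.stateGen_mem (x := x) ⟨hu0, hu1.le⟩ hv ht).1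
  have h5 : 0 ≤ t * (stateGen p x v u t - stateGen p x v 0 t) :=
    mul_nonneg ht (sub_nonneg.2 (hp.stateGen_mono le_rfl hu0 hu1.le hv ht))
  have h6 : 0 ≤ ∫ σ in (0 : ℝ)..t, stateGenDeriv p x v u σ := h5.trans h1
  have h7 := mul_le_mul_of_nonneg_left h1 hc.le
  have h8 := mul_le_mul_of_nonneg_right hneg.le h6
  linarith

/-! ### Impossible transitions -/

/-- The mark vector with value `ε` at `m` and `1` elsewhere, which isolates the counter `Y_m`. -/
def singleMark (m : N) (ε : ℝ) (k : N) : ℝ := if k = m then ε else 1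

theorem singleMark_mem (m : N) {ε : ℝ} (hε : ε ∈ Icc (0 : ℝ) 1) (k : N) :
    singleMark m ε k ∈ Icc (0 : ℝ) 1 := by
  unfold singleMark
  split_ifs
  · exact hε
  · exact ⟨zero_le_one, le_rfl⟩

theorem stateMonomial_singleMark (m : N) (ε u : ℝ) (z : CrossState N) :
    stateMonomial u (singleMark m ε) z = u ^ z.1 * ε ^ z.2 m := by
  rw [stateMonomial, Finset.prod_eq_single m]
  · simp [singleMark]
  · intro k _ hk
    simp [singleMark, hk]
  · simp

/-- The counters cannot decrease. With `ε` the mark of `m`, `E_x[u ^ X(t) * ε ^ Y_m(t)] ≤ ε ^ x.2 m` for `u`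
near `1`, which for small `ε` leaves no mass on smaller values of `Y_m`. -/
theorem transition_eq_zero_of_counter_lt (hb : IsBranchingRates b) (hN1 : 1 ∉ N)
    (hNpos : ∀ k ∈ N, 0 < b k) (hp : IsTransitionFunction p)
    (hfwd : ForwardEquation p (crossingQ b N)) {t : ℝ} (ht : 0 ≤ t) {x z : CrossState N} {m : N}
    (hm : z.2 m < x.2 m) : p t x z = 0 := by
  refine le_antisymm (le_of_forall_gt_imp_ge_of_dense fun ε hε => ?_) (hp.nonneg t ht x z)
  rcases le_or_gt 1 ε with h1 | h1
  · have h2 := le_hasSum (hp.honest t ht x) z fun y _ => hp.nonneg t ht x y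
    exact h2.trans h1
  have hv := singleMark_mem m (ε := ε) ⟨hε.le, h1.le⟩
  have hk : singleMark m ε m ≠ 1 := by simpa [singleMark] using h1.ne
  obtain ⟨c, hc, hev⟩ := eventually_markedGen_lt hb hN1 hNpos hv hk
  have hlim : Tendsto (fun u : ℝ => p t x z * (u ^ z.1 * ε ^ z.2 m)) (𝓝[<] 1)
      (𝓝 (p t x z * (1 ^ z.1 * ε ^ z.2 m))) := by
    have : Continuous fun u : ℝ => p t x z * (u ^ z.1 * ε ^ z.2 m) := by fun_prop
    exact (this.tendsto 1).mono_left nhdsWithin_le_nhds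
  have h2 : p t x z * (1 ^ z.1 * ε ^ z.2 m) ≤ ε ^ x.2 m := by
    refine le_of_tendsto hlim ?_
    filter_upwards [hev] with u hu
    obtain ⟨hu0, hu1, hneg⟩ := hu
    have hanti := antitoneOn_stateGen (x := x) hb hp hfwd hu0 hu1 hv (by linarith)
      self_mem_Ici ht ht
    rw [hp.stateGen_zero, stateMonomial_singleMark] at hanti
    have h3 := le_hasSum (hp.summable_stateGen (x := x) ⟨hu0, hu1.le⟩ hv ht).hasSum z fun y _ =>
      mul_nonneg (hp.nonneg t ht x y) (stateMonomial_mem ⟨hu0, hu1.le⟩ hv y).1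
    rw [stateMonomial_singleMark] at h3
    exact h3.trans (hanti.trans (mul_le_of_le_one_left (pow_nonneg hε.le _)
      (pow_le_one₀ hu0 hu1.le)))
  have h3 : ε ^ x.2 m ≤ ε * ε ^ z.2 m := by
    rw [← pow_succ']
    exact pow_le_pow_of_le_one hε.le h1.le hm
  rw [one_pow, one_mul] at h2
  exact le_of_mul_le_mul_right (h2.trans h3) (pow_pos hε _)

theorem monotoneOn_transition_of_fst_eq_zero (hb : IsBranchingRates b)
    (hp : IsTransitionFunction p) (hfwd : ForwardEquation p (crossingQ b N)) (x : CrossState N)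
    {z : CrossState N} (hz : z.1 = 0) : MonotoneOn (fun t => p t x z) (Ici 0) := by
  refine monotoneOn_of_hasDerivWithinAt_nonneg (convex_Ici 0) (hfwd.continuousOn x z)
    (fun t ht => (hfwd x z t (interior_subset ht)).2.mono interior_subset) fun t ht => ?_
  refine tsum_nonneg fun y => mul_nonneg (hp.nonneg t (interior_subset ht) x y) ?_
  unfold crossingQ
  split_ifs with h
  · have hy : y.1 = 1 := by omega
    rw [hy, hz]
    exact mul_nonneg (by norm_num) (hb.nonneg _ (by norm_num))
  · exact le_rfl

theorem transition_eq_zero_of_fst_eq_zero (hb : IsBranchingRates b)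
    (hp : IsTransitionFunction p) (hfwd : ForwardEquation p (crossingQ b N)) {x z : CrossState N}
    (hx : x.1 = 0) (hxz : z ≠ x) {t : ℝ} (ht : 0 ≤ t) : p t x z = 0 := by
  have h1 : 1 ≤ p t x x := by
    have := monotoneOn_transition_of_fst_eq_zero hb hp hfwd x hx self_mem_Ici ht ht
    simpa [hp.zero] using this
  have h2 := sum_le_hasSum {x, z} (fun y _ => hp.nonneg t ht x y) (hp.honest t ht x)
  rw [Finset.sum_pair hxz.symm] at h2
  exact le_antisymm (by linarith) (hp.nonneg t ht x z)

theorem hasSum_stateGen_zero (hp : IsTransitionFunction p) (hv : ∀ k, v k ∈ Icc (0 : ℝ) 1)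
    {t : ℝ} (ht : 0 ≤ t) :
    HasSum (fun l : N → ℕ => p t x (0, l) * ∏ k, v k ^ l k) (stateGen p x v 0 t) := by
  have hinj : Function.Injective fun l : N → ℕ => ((0, l) : CrossState N) :=
    fun l l' h => congrArg Prod.snd h
  have h := (hinj.hasSum_iff fun z hz => ?_).2
    (hp.summable_stateGen (x := x) (u := 0) ⟨le_rfl, zero_le_one⟩ hv ht).hasSum
  · exact h.congr_fun fun l => by simp [stateMonomial]
  · have : z.1 ≠ 0 := fun h0 => hz ⟨z.2, Prod.ext h0.symm rfl⟩
    simp [stateMonomial, this]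

end Longtime

/-! ### The extinction time -/

section ExtinctionTime

variable {Ω : Type*} {N : Finset ℕ} {Z : ℝ≥0 → Ω → CrossState N}

theorem extinctionTime_lt_top_iff {ω : Ω} :
    extinctionTime Z ω < ⊤ ↔ ∃ t, (Z t ω).1 = 0 := by
  simp [extinctionTime, iInf_lt_iff]

theorem extinctionTime_toNNReal_le {ω : Ω} {t : ℝ≥0} (h : (Z t ω).1 = 0) :
    (extinctionTime Z ω).toNNReal ≤ t := by
  have h1 : extinctionTime Z ω ≤ t := iInf₂_le t h
  simpa using ENNReal.toNNReal_mono ENNReal.coe_ne_top h1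

variable [MeasurableSpace Ω] {μ : Measure Ω} {p : ℝ → CrossState N → CrossState N → ℝ}
  {z₀ : CrossState N}

theorem IsMarkovChain.measurableSet_preimage (hZ : IsMarkovChain μ p z₀ Z) (t : ℝ≥0)
    (C : Set (CrossState N)) :
    MeasurableSet {ω | Z t ω ∈ C} :=
  hZ.measurable t (Set.to_countable C).measurableSet

/-- By right-continuity the infimum defining the extinction time is attained. -/
theorem fst_extinctionTime_eq_zero (hZ : IsMarkovChain μ p z₀ Z) {ω : Ω}
    (h : extinctionTime Z ω < ⊤) : (Z (extinctionTime Z ω).toNNReal ω).1 = 0 := by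
  obtain ⟨c, hc, hcs⟩ := mem_nhdsGE_iff_exists_Ico_subset.1
    (hZ.rightCont ω (extinctionTime Z ω).toNNReal)
  have h1 : extinctionTime Z ω < c := by
    rw [← ENNReal.coe_toNNReal h.ne]
    exact_mod_cast hc
  simp only [extinctionTime, iInf_lt_iff] at h1
  obtain ⟨s, hs, hsc⟩ := h1
  have h2 : Z s ω = Z (extinctionTime Z ω).toNNReal ω :=
    hcs ⟨extinctionTime_toNNReal_le hs, by exact_mod_cast hsc⟩
  rw [← h2, hs]

theorem measurableSet_extinction (hZ : IsMarkovChain μ p z₀ Z) :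
    MeasurableSet {ω | extinctionTime Z ω < ⊤} := by
  set d : ℕ → ℝ≥0 := TopologicalSpace.denseSeq ℝ≥0
  have hd : Dense (range d) := TopologicalSpace.denseRange_denseSeq ℝ≥0
  have h : {ω | extinctionTime Z ω < ⊤} = ⋃ i, {ω | Z (d i) ω ∈ {z | z.1 = 0}} := by
    ext ω
    rw [mem_ofPred_eq, extinctionTime_lt_top_iff, mem_iUnion]
    refine ⟨fun ⟨t, ht⟩ => ?_, fun ⟨i, hi⟩ => ⟨d i, hi⟩⟩
    obtain ⟨c, hc, hcs⟩ := mem_nhdsGE_iff_exists_Ico_subset.1 (hZ.rightCont ω t)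
    obtain ⟨_, ⟨i, rfl⟩, hi⟩ := hd.exists_between hc
    have h1 : Z (d i) ω = Z t ω := hcs ⟨hi.1.le, hi.2⟩
    exact ⟨i, by simp [h1, ht]⟩
  rw [h]
  exact MeasurableSet.iUnion fun i => hZ.measurableSet_preimage _ _

end ExtinctionTime

/-! ### From transition probabilities to paths -/

section Paths

variable {Ω : Type*} [MeasurableSpace Ω] {μ : Measure Ω} [IsProbabilityMeasure μ]
  {b : ℕ → ℝ} {N : Finset ℕ} {v : N → ℝ}
  {p : ℝ → CrossState N → CrossState N → ℝ} {z₀ : CrossState N} {Z : ℝ≥0 → Ω → CrossState N}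

namespace IsMarkovChain

theorem ae_zero_eq (hZ : IsMarkovChain μ p z₀ Z) : ∀ᵐ ω ∂μ, Z 0 ω = z₀ := by
  have h := hZ.fdd 0 (fun _ => 0) rfl monotone_const fun _ => z₀
  simp only [forall_const, if_true, Finset.univ_eq_empty, Finset.prod_empty, mul_one] at h
  have hm : MeasurableSet {ω | Z 0 ω = z₀} := hZ.measurableSet_preimage 0 {z₀}
  rw [measureReal_def, ENNReal.toReal_eq_one_iff] at h
  exact (mem_ae_iff_prob_eq_one hm).2 h

theorem measureReal_eq (hZ : IsMarkovChain μ p z₀ Z) (t : ℝ≥0) (z : CrossState N) :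
    μ.real {ω | Z t ω = z} = p t z₀ z := by
  have hmono : Monotone ![(0 : ℝ≥0), t] := by
    intro i j hij
    fin_cases i <;> fin_cases j <;> simp_all
  have h := hZ.fdd 1 ![0, t] rfl hmono ![z₀, z]
  simp [Fin.forall_fin_two] at h
  rw [← h]
  refine measureReal_congr ?_
  filter_upwards [hZ.ae_zero_eq] with ω hω
  exact propext ⟨fun h => ⟨hω, h⟩, fun h => h.2⟩

theorem measure_pair_eq_zero (hZ : IsMarkovChain μ p z₀ Z) {s t : ℝ≥0} (hst : s ≤ t)
    {x y : CrossState N} (hxy : p ((t : ℝ) - s) x y = 0) :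
    μ {ω | Z s ω = x ∧ Z t ω = y} = 0 := by
  have hmono : Monotone ![(0 : ℝ≥0), s, t] := by
    intro i j hij
    fin_cases i <;> fin_cases j <;> simp_all
  have h := hZ.fdd 2 ![0, s, t] rfl hmono ![z₀, x, y]
  simp [Fin.forall_fin_succ, Fin.prod_univ_succ, hxy] at h
  rw [measureReal_eq_zero_iff] at h
  refine measure_mono_null_ae ?_ h
  filter_upwards [hZ.ae_zero_eq] with ω hω h
  exact ⟨hω, h.1, h.2⟩

/-- A relation that holds along all transitions of positive probability almost surely holds along
the path: along a countable dense set of times first, then at all times by right-continuity. -/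
theorem ae_forall_le_rel (hZ : IsMarkovChain μ p z₀ Z) {R : CrossState N → CrossState N → Prop}
    (hrefl : ∀ x, R x x) (hR : ∀ t, 0 ≤ t → ∀ x y, ¬ R x y → p t x y = 0) :
    ∀ᵐ ω ∂μ, ∀ s t, s ≤ t → R (Z s ω) (Z t ω) := by
  set d : ℕ → ℝ≥0 := TopologicalSpace.denseSeq ℝ≥0
  have hd : Dense (range d) := TopologicalSpace.denseRange_denseSeq ℝ≥0
  have hcount : ∀ᵐ ω ∂μ, ∀ i j, d i ≤ d j → R (Z (d i) ω) (Z (d j) ω) := by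
    refine ae_all_iff.2 fun i => ae_all_iff.2 fun j => ?_
    by_cases hij : d i ≤ d j
    · have hsub : {ω | ¬ (d i ≤ d j → R (Z (d i) ω) (Z (d j) ω))} ⊆
          ⋃ q : {q : CrossState N × CrossState N // ¬ R q.1 q.2},
            {ω | Z (d i) ω = q.1.1 ∧ Z (d j) ω = q.1.2} := fun ω hω =>
        mem_iUnion.2 ⟨⟨(Z (d i) ω, Z (d j) ω), fun h => hω fun _ => h⟩, rfl, rfl⟩
      refine measure_mono_null hsub (measure_iUnion_null fun q => ?_)
      exact hZ.measure_pair_eq_zero hij (hR _ (sub_nonneg.2 (by exact_mod_cast hij)) _ _ q.2)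
    · exact Eventually.of_forall fun ω h => absurd h hij
  filter_upwards [hcount] with ω hω s t hst
  rcases hst.eq_or_lt with rfl | hst
  · exact hrefl _
  obtain ⟨c, hc, hcs⟩ := mem_nhdsGE_iff_exists_Ico_subset.1 (hZ.rightCont ω s)
  obtain ⟨e, he, het⟩ := mem_nhdsGE_iff_exists_Ico_subset.1 (hZ.rightCont ω t)
  obtain ⟨_, ⟨i, rfl⟩, hi⟩ := hd.exists_between (lt_min hc hst)
  obtain ⟨_, ⟨j, rfl⟩, hj⟩ := hd.exists_between he
  have h1 : Z (d i) ω = Z s ω := hcs ⟨hi.1.le, hi.2.trans_le (min_le_left _ _)⟩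
  have h2 : Z (d j) ω = Z t ω := het ⟨hj.1.le, hj.2⟩
  rw [← h1, ← h2]
  exact hω i j ((hi.2.trans_le (min_le_right _ _)).trans hj.1).le

theorem measureReal_mem (hZ : IsMarkovChain μ p z₀ Z) (t : ℝ≥0) (C : Set (CrossState N)) :
    μ.real {ω | Z t ω ∈ C} = ∑' z, C.indicator (p t z₀) z := by
  have h := tsum_measure_preimage_singleton (μ := μ) (s := C) (Set.to_countable C) (f := Z t)
    fun y _ => hZ.measurableSet_preimage t {y}
  have h2 : μ.real {ω | Z t ω ∈ C} = (∑' z : C, μ (Z t ⁻¹' {(z : CrossState N)})).toReal := by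
    rw [h]; rfl
  rw [h2, ENNReal.tsum_toReal_eq fun z => measure_ne_top _ _, ← tsum_subtype]
  exact tsum_congr fun z => hZ.measureReal_eq t z

/-- Almost surely the counters do not decrease, and no state without particles is left. -/
theorem ae_path (hb : IsBranchingRates b) (hN1 : 1 ∉ N) (hNpos : ∀ k ∈ N, 0 < b k)
    (hp : IsTransitionFunction p) (hfwd : ForwardEquation p (crossingQ b N))
    (hZ : IsMarkovChain μ p z₀ Z) :
    ∀ᵐ ω ∂μ, ∀ s t, s ≤ t →
      (∀ m, (Z s ω).2 m ≤ (Z t ω).2 m) ∧ ((Z s ω).1 = 0 → Z t ω = Z s ω) := by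
  refine hZ.ae_forall_le_rel (R := fun x y => (∀ m, x.2 m ≤ y.2 m) ∧ (x.1 = 0 → y = x))
    (fun x => ⟨fun _ => le_rfl, fun _ => rfl⟩) fun t ht x y hxy => ?_
  rw [not_and_or] at hxy
  rcases hxy with h | h
  · push Not at h
    obtain ⟨m, hm⟩ := h
    exact transition_eq_zero_of_counter_lt hb hN1 hNpos hp hfwd ht hm
  · push Not at h
    exact transition_eq_zero_of_fst_eq_zero hb hp hfwd h.1 h.2 ht

end IsMarkovChain

/-! ### Extinction and the crossing numbers at extinction -/

/-- Up to a null set, extinction with crossing numbers `l` means reaching the state `(0, l)` at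
some integer time. -/
theorem extinction_inter_crossing_ae_eq (hb : IsBranchingRates b) (hN1 : 1 ∉ N)
    (hNpos : ∀ k ∈ N, 0 < b k) (hp : IsTransitionFunction p)
    (hfwd : ForwardEquation p (crossingQ b N)) (hZ : IsMarkovChain μ p z₀ Z) (l : N → ℕ) :
    ({ω | extinctionTime Z ω < ⊤} ∩ {ω | crossingAtExtinction Z ω = l} : Set Ω) =ᵐ[μ]
      ⋃ n : ℕ, {ω | Z n ω = (0, l)} := by
  filter_upwards [hZ.ae_path hb hN1 hNpos hp hfwd] with ω hω
  refine propext ⟨fun ⟨hτ, hl⟩ => ?_, fun h => ?_⟩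
  · have h0 := fst_extinctionTime_eq_zero hZ hτ
    obtain ⟨n, hn⟩ := exists_nat_ge (extinctionTime Z ω).toNNReal
    exact mem_iUnion.2 ⟨n, ((hω _ _ hn).2 h0).trans (Prod.ext h0 hl)⟩
  · obtain ⟨n, hn⟩ := mem_iUnion.1 h
    have hn : Z n ω = (0, l) := hn
    have hn0 : (Z n ω).1 = 0 := by rw [hn]
    have hτ : extinctionTime Z ω < ⊤ := extinctionTime_lt_top_iff.2 ⟨n, hn0⟩
    refine ⟨hτ, ?_⟩
    have h2 := (hω _ _ (extinctionTime_toNNReal_le hn0)).2 (fst_extinctionTime_eq_zero hZ hτ)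
    rw [hn] at h2
    exact (congrArg Prod.snd h2).symm

theorem tendsto_transition_extinct (hb : IsBranchingRates b) (hN1 : 1 ∉ N)
    (hNpos : ∀ k ∈ N, 0 < b k) (hp : IsTransitionFunction p)
    (hfwd : ForwardEquation p (crossingQ b N)) (hZ : IsMarkovChain μ p z₀ Z) (l : N → ℕ) :
    Tendsto (fun n : ℕ => p n z₀ (0, l)) atTop
      (𝓝 (μ.real ({ω | extinctionTime Z ω < ⊤} ∩ {ω | crossingAtExtinction Z ω = l}))) := by
  have hmeas : ∀ n : ℕ, MeasurableSet {ω | Z n ω = (0, l)} := fun n =>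
    hZ.measurableSet_preimage n {(0, l)}
  have h := tendsto_measure_of_ae_tendsto_indicator_of_isFiniteMeasure (μ := μ) atTop
    (MeasurableSet.iUnion hmeas) hmeas (by
      filter_upwards [hZ.ae_path hb hN1 hNpos hp hfwd] with ω hω
      by_cases hex : ∃ n : ℕ, Z n ω = (0, l)
      · obtain ⟨n, hn⟩ := hex
        filter_upwards [eventually_ge_atTop n] with m hm
        refine ⟨fun h => mem_iUnion.2 ⟨m, h⟩, fun _ => ?_⟩
        exact ((hω n m (by exact_mod_cast hm)).2 (by rw [hn])).trans hn
      · refine Eventually.of_forall fun m => ⟨fun h => mem_iUnion.2 ⟨m, h⟩, fun h => ?_⟩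
        exact absurd (mem_iUnion.1 h) hex)
  rw [measureReal_congr (extinction_inter_crossing_ae_eq hb hN1 hNpos hp hfwd hZ l)]
  refine ((ENNReal.tendsto_toReal (measure_ne_top _ _)).comp h).congr fun n => ?_
  exact hZ.measureReal_eq n (0, l)

/-- The generating function of the crossing numbers on the event of extinction. -/
theorem hasSum_extinction_inter_crossing (hb : IsBranchingRates b) (hN1 : 1 ∉ N)
    (hNpos : ∀ k ∈ N, 0 < b k) (hp : IsTransitionFunction p)
    (hfwd : ForwardEquation p (crossingQ b N)) (hZ : IsMarkovChain μ p (1, 0) Z)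
    (hv : ∀ k, v k ∈ Icc (0 : ℝ) 1) :
    HasSum (fun l : N → ℕ =>
      μ.real ({ω | extinctionTime Z ω < ⊤} ∩ {ω | crossingAtExtinction Z ω = l}) *
        ∏ k, v k ^ l k) (rhoN b N v) := by
  set π : (N → ℕ) → ℝ := fun l =>
    μ.real ({ω | extinctionTime Z ω < ⊤} ∩ {ω | crossingAtExtinction Z ω = l}) with hπ
  have hlim : ∀ l, Tendsto (fun n : ℕ => p n (1, 0) (0, l)) atTop (𝓝 (π l)) :=
    tendsto_transition_extinct hb hN1 hNpos hp hfwd hZ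
  have hle : ∀ (n : ℕ) l, p n (1, 0) (0, l) ≤ π l := fun n l => by
    refine Monotone.ge_of_tendsto (fun i j hij => ?_) (hlim l) n
    exact monotoneOn_transition_of_fst_eq_zero hb hp hfwd (1, 0) (z := (0, l)) rfl
      (Nat.cast_nonneg (α := ℝ) i) (Nat.cast_nonneg (α := ℝ) j) (by exact_mod_cast hij)
  have hsum : Summable π := by
    refine summable_of_sum_le (c := 1) (fun l => measureReal_nonneg) fun F => ?_
    refine le_of_tendsto (tendsto_finsetSum F fun l _ => hlim l) (Eventually.of_forall fun n => ?_)
    have hinj : Function.Injective fun l : N → ℕ => ((0, l) : CrossState N) :=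
      fun l l' h => congrArg Prod.snd h
    have h := sum_le_hasSum (F.map ⟨_, hinj⟩)
      (fun y _ => hp.nonneg n n.cast_nonneg (1, 0) y) (hp.honest n n.cast_nonneg (1, 0))
    rwa [Finset.sum_map] at h
  have hdom : Tendsto (fun n : ℕ => ∑' l : N → ℕ, p n (1, 0) (0, l) * ∏ k, v k ^ l k) atTop
      (𝓝 (∑' l : N → ℕ, π l * ∏ k, v k ^ l k)) := by
    refine tendsto_tsum_of_dominated_convergence hsum (fun l => (hlim l).mul_const _)
      (Eventually.of_forall fun n l => ?_)
    have h1 := hp.nonneg n n.cast_nonneg (1, 0) (0, l)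
    have h2 := prod_pow_mem hv l
    rw [Real.norm_eq_abs, abs_of_nonneg (mul_nonneg h1 h2.1)]
    exact (mul_le_of_le_one_right h1 h2.2).trans (hle n l)
  have hgen : Tendsto (fun n : ℕ => ∑' l : N → ℕ, p n (1, 0) (0, l) * ∏ k, v k ^ l k) atTop
      (𝓝 (rhoN b N v)) :=
    ((tendsto_stateGen_zero hb hN1 hp hfwd hv).comp tendsto_natCast_atTop_atTop).congr fun n =>
      (hasSum_stateGen_zero hp hv n.cast_nonneg).tsum_eq.symm
  rw [tendsto_nhds_unique hgen hdom]
  refine (hsum.of_nonneg_of_le (fun l => mul_nonneg measureReal_nonneg (prod_pow_mem hv l).1)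
    fun l => mul_le_of_le_one_right measureReal_nonneg (prod_pow_mem hv l).2).hasSum

theorem measureReal_extinction (hb : IsBranchingRates b) (hN1 : 1 ∉ N)
    (hNpos : ∀ k ∈ N, 0 < b k) (hp : IsTransitionFunction p)
    (hfwd : ForwardEquation p (crossingQ b N)) (hZ : IsMarkovChain μ p (1, 0) Z) :
    μ.real {ω | extinctionTime Z ω < ⊤} = rho b := by
  have h := hasSum_extinction_inter_crossing (v := 1) hb hN1 hNpos hp hfwd hZ
    fun k => ⟨zero_le_one, le_rfl⟩
  simp only [Pi.one_apply, one_pow, Finset.prod_const_one, mul_one, hb.rhoN_one] at h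
  rw [← h.tsum_eq]
  have hun : {ω | extinctionTime Z ω < ⊤} = ⋃ l : N → ℕ,
      ({ω | extinctionTime Z ω < ⊤} ∩ {ω | crossingAtExtinction Z ω = l}) := by
    ext ω
    simp
  have hmeas : ∀ l : N → ℕ, NullMeasurableSet
      ({ω | extinctionTime Z ω < ⊤} ∩ {ω | crossingAtExtinction Z ω = l}) μ := fun l =>
    (MeasurableSet.iUnion fun n : ℕ =>
      hZ.measurableSet_preimage n {(0, l)}).nullMeasurableSet.congr
        (extinction_inter_crossing_ae_eq hb hN1 hNpos hp hfwd hZ l).symm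
  have hdisj : Pairwise (Function.onFun (AEDisjoint μ) fun l : N → ℕ =>
      ({ω | extinctionTime Z ω < ⊤} ∩ {ω | crossingAtExtinction Z ω = l} : Set Ω)) :=
    fun l l' hl => Disjoint.aedisjoint <| Set.disjoint_left.2 fun ω h h' =>
      hl (h.2.symm.trans h'.2)
  have hm := measure_iUnion₀ hdisj hmeas
  rw [← hun] at hm
  rw [measureReal_def, hm, ENNReal.tsum_toReal_eq fun l => measure_ne_top _ _]
  rfl

/-! ### Crossing numbers of the surviving process -/

/-- Survival with a bounded counter `Y_m` at all integer times has probability zero, because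
`P(X(t) ≥ 1, Y_m(t) ≤ M) ≤ 2 ^ M * E[(1 / 2) ^ Y_m(t); X(t) ≥ 1]`, which tends to zero. -/
theorem measure_survival_counter_le (hb : IsBranchingRates b) (hN1 : 1 ∉ N)
    (hNpos : ∀ k ∈ N, 0 < b k) (hp : IsTransitionFunction p)
    (hfwd : ForwardEquation p (crossingQ b N)) (hZ : IsMarkovChain μ p z₀ Z) (m : N) (M : ℕ) :
    μ (⋂ n : ℕ, {ω | Z n ω ∈ {z : CrossState N | z.1 ≠ 0 ∧ z.2 m ≤ M}}) = 0 := by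
  set I : Set Ω := ⋂ n : ℕ, {ω | Z n ω ∈ {z : CrossState N | z.1 ≠ 0 ∧ z.2 m ≤ M}} with hI
  have hv := singleMark_mem m (ε := 1 / 2) ⟨by norm_num, by norm_num⟩
  obtain ⟨c, hc, hbound⟩ := exists_mul_stateGen_sub_le (k := m) hb hN1 hNpos hp hfwd hv
    (by norm_num [singleMark]) z₀
  have hle : ∀ n : ℕ, μ.real I ≤ 2 ^ M *
      (stateGen p z₀ (singleMark m (1 / 2)) 1 n - stateGen p z₀ (singleMark m (1 / 2)) 0 n) := by
    intro n
    refine (measureReal_mono (iInter_subset _ n)).trans ?_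
    have hn : (0 : ℝ) ≤ n := n.cast_nonneg
    have h1 := hp.summable_stateGen (x := z₀) (u := 1) ⟨zero_le_one, le_rfl⟩ hv hn
    have h2 := hp.summable_stateGen (x := z₀) (u := 0) ⟨le_rfl, zero_le_one⟩ hv hn
    rw [hZ.measureReal_mem, stateGen, stateGen, ← h1.tsum_sub h2, ← tsum_mul_left]
    refine ((hp.honest n hn z₀).summable.indicator _).tsum_le_tsum (fun z => ?_)
      ((h1.sub h2).mul_left _)
    have hpz := hp.nonneg n hn z₀ z
    simp only [stateMonomial_singleMark, one_pow, one_mul, ← mul_sub, NNReal.coe_natCast]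
    by_cases hz : z ∈ {z : CrossState N | z.1 ≠ 0 ∧ z.2 m ≤ M}
    · rw [indicator_of_mem hz, zero_pow hz.1, zero_mul, sub_zero]
      have h3 : (1 / 2 : ℝ) ^ M ≤ (1 / 2) ^ z.2 m :=
        pow_le_pow_of_le_one (by norm_num) (by norm_num) hz.2
      have h4 : (1 : ℝ) ≤ 2 ^ M * (1 / 2) ^ z.2 m :=
        calc (1 : ℝ) = 2 ^ M * (1 / 2) ^ M := by rw [← mul_pow]; norm_num
          _ ≤ _ := mul_le_mul_of_nonneg_left h3 (by positivity)
      have h5 := mul_le_mul_of_nonneg_left h4 hpz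
      linarith
    · rw [indicator_of_notMem hz]
      have h6 : (0 : ℝ) ^ z.1 ≤ 1 := pow_le_one₀ le_rfl zero_le_one
      have h7 : (0 : ℝ) ≤ (1 / 2) ^ z.2 m := by positivity
      have h8 := mul_le_mul_of_nonneg_right h6 h7
      exact mul_nonneg (by positivity) (mul_nonneg hpz (by linarith))
  rw [← measureReal_eq_zero_iff]
  by_contra hne
  have hpos : 0 < μ.real I := lt_of_le_of_ne measureReal_nonneg (Ne.symm hne)
  obtain ⟨n, hn⟩ := exists_nat_gt ((2 : ℝ) ^ M / (c * μ.real I))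
  rw [div_lt_iff₀ (mul_pos hc hpos)] at hn
  have h1 := hbound n n.cast_nonneg
  have h2 : (0 : ℝ) ≤ c * n := by positivity
  have h3 := mul_le_mul_of_nonneg_left (hle n) h2
  have h4 := mul_le_mul_of_nonneg_left h1 (by positivity : (0 : ℝ) ≤ 2 ^ M)
  linarith

theorem ae_tendsto_counter_of_survival (hb : IsBranchingRates b) (hN1 : 1 ∉ N)
    (hNpos : ∀ k ∈ N, 0 < b k) (hp : IsTransitionFunction p)
    (hfwd : ForwardEquation p (crossingQ b N)) (hZ : IsMarkovChain μ p z₀ Z) :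
    ∀ᵐ ω ∂μ, extinctionTime Z ω = ⊤ →
      ∀ m : N, Tendsto (fun t => (Z t ω).2 m) atTop atTop := by
  have hnull : ∀ᵐ ω ∂μ, ∀ (m : N) (M : ℕ),
      ω ∉ ⋂ n : ℕ, {ω | Z n ω ∈ {z : CrossState N | z.1 ≠ 0 ∧ z.2 m ≤ M}} :=
    ae_all_iff.2 fun m => ae_all_iff.2 fun M =>
      measure_eq_zero_iff_ae_notMem.1 (measure_survival_counter_le hb hN1 hNpos hp hfwd hZ m M)
  filter_upwards [hZ.ae_path hb hN1 hNpos hp hfwd, hnull] with ω hω hω' hτ m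
  have hX : ∀ t, (Z t ω).1 ≠ 0 := fun t ht =>
    (extinctionTime_lt_top_iff.2 ⟨t, ht⟩).ne hτ
  refine tendsto_atTop.2 fun M => ?_
  have h := hω' m M
  simp only [mem_iInter, mem_ofPred_eq, not_forall] at h
  obtain ⟨n, hn⟩ := h
  filter_upwards [eventually_ge_atTop (n : ℝ≥0)] with t ht
  have h1 : M < (Z n ω).2 m := by
    by_contra! h2
    exact hn ⟨hX n, h2⟩
  exact h1.le.trans ((hω _ _ ht).1 m)

end Paths

/-! ### Extinction, crossing numbers and the flow -/

theorem theorem3p3 {Ω : Type*} [MeasurableSpace Ω] (μ : Measure Ω) [IsProbabilityMeasure μ]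
    (b : ℕ → ℝ) (hb : IsBranchingRates b)
    (N : Finset ℕ) (hN1 : 1 ∉ N) (hNpos : ∀ k ∈ N, 0 < b k)
    (p : ℝ → CrossState N → CrossState N → ℝ) (hp : IsTransitionFunction p)
    (hfwd : ForwardEquation p (crossingQ b N))
    (Z : ℝ≥0 → Ω → CrossState N) (hZ : IsMarkovChain μ p (1, 0) Z) :
    -- `ρ` and `ρ(v)` are the minimal nonnegative roots, and `ρ` is the extinction probability
    IsLeast (rootsB b) (rho b) ∧
    (∀ v : N → ℝ, (∀ k, v k ∈ Icc (0 : ℝ) 1) → IsLeast (rootsBN b N v) (rhoN b N v)) ∧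
    μ.real {ω | extinctionTime Z ω < ⊤} = rho b ∧
    -- the generating function of `Y(τ)` given `τ < ∞` is `ρ⁻¹ ρ(v)`
    (0 < rho b → ∀ v : N → ℝ, (∀ k, v k ∈ Icc (0 : ℝ) 1) →
      HasSum (fun l : N → ℕ =>
          (μ[|{ω | extinctionTime Z ω < ⊤}]).real {ω | crossingAtExtinction Z ω = l} *
            ∏ k, v k ^ l k)
        ((rho b)⁻¹ * rhoN b N v)) ∧
    -- `G(t, 1, v)` is well defined and `G(∞, 1, v) = ρ(v)`
    (∀ v : N → ℝ, (∀ k, v k ∈ Icc (0 : ℝ) 1) → ((∃ k, v k ≠ 1) ∨ rho b = 1) →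
      ∃ G : ℝ → ℝ, IsFlow b N v 1 G ∧
        (∀ y, IsFlow b N v 1 y → ∀ t, 0 ≤ t → y t = G t) ∧
        Tendsto G atTop (𝓝 (rhoN b N v))) ∧
    -- if `ρ < 1`, then `P(Y(∞) = ∞ | τ = ∞) = 1`
    (rho b < 1 →
      μ[|{ω | extinctionTime Z ω = ⊤}]
        {ω | ∀ k : N, Tendsto (fun t => (Z t ω).2 k) atTop atTop} = 1) := by
  have hA := measurableSet_extinction hZ
  have hext := measureReal_extinction hb hN1 hNpos hp hfwd hZ
  have hone : ∀ k : N, (1 : N → ℝ) k ∈ Icc (0 : ℝ) 1 := fun k => ⟨zero_le_one, le_rfl⟩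
  refine ⟨?_, fun v hv => hb.isLeast_rhoN hN1 hv, hext, fun hρ v hv => ?_, fun v hv h => ?_,
    fun hρ => ?_⟩
  · have h := hb.isLeast_rhoN hN1 hone
    rwa [hb.rhoN_one, hb.rootsBN_eq, ← IsBranchingRates.rootsB_eq] at h
  · refine ((hasSum_extinction_inter_crossing hb hN1 hNpos hp hfwd hZ hv).mul_left
      (rho b)⁻¹).congr_fun fun l => ?_
    rw [measureReal_def, cond_apply hA, ENNReal.toReal_mul, ENNReal.toReal_inv, ← mul_assoc,
      ← measureReal_def, ← measureReal_def, hext]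
  · by_cases hk : ∃ k, v k ≠ 1
    · obtain ⟨k, hk⟩ := hk
      exact hb.exists_flow_of_ne_one hN1 hNpos hv hk
    · have hv1 : v = 1 := by
        push Not at hk
        exact funext hk
      have hρ : rho b = 1 := h.resolve_left hk
      exact hb.exists_flow_of_rhoN_eq_one hN1 hv (by rw [hv1, hb.rhoN_one, hρ])
  · have hcompl : {ω | extinctionTime Z ω = ⊤} = {ω | extinctionTime Z ω < ⊤}ᶜ := by
      ext ω
      simp
    have hpos : μ {ω | extinctionTime Z ω = ⊤} ≠ 0 := by
      rw [hcompl, Ne, prob_compl_eq_zero_iff hA, ← ENNReal.toReal_eq_one_iff, ← measureReal_def, hext]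
      exact hρ.ne
    have := cond_isProbabilityMeasure hpos
    have hae : ∀ᵐ ω ∂μ[|{ω | extinctionTime Z ω = ⊤}],
        ∀ k : N, Tendsto (fun t => (Z t ω).2 k) atTop atTop := by
      have hm : MeasurableSet {ω | extinctionTime Z ω = ⊤} := hcompl ▸ hA.compl
      rw [ae_iff, cond_apply hm]
      refine mul_eq_zero_of_right _ (measure_mono_null (fun ω hω => ?_)
        (ae_iff.1 (ae_tendsto_counter_of_survival hb hN1 hNpos hp hfwd hZ)))
      exact fun h => hω.2 (h hω.1)
    rw [measure_congr (eventuallyEq_univ.2 hae), measure_univ]
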